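/- **Setting.** Let $p$ be an odd prime and $R$ a domain of characteristic zero which is $p$-adically separated and complete. Let $f=\sum_{\mathbf w} v_{\mathbf w}\mathbf x^{\mathbf w}\in R[x_1^{\pm1},\dots,x_n^{\pm1}]$ have Newton polytope $\Delta\subset\mathbb R^n$. Let $\mu\subseteq\Delta$ be open, i.e. $\Delta\setminus\mu$ is a union of faces of $\Delta$, and put $\mu_{\mathbb Z}=\mu\cap\mathbb Z^n$, $h=\#\mu_{\mathbb Z}$. Let $\Omega_f(\mu)$ be the $R$-module generated by the rational functions $(k-1)!\,g/f^k$ with $k\ge1$, $\operatorname{supp}(g)\subset k\mu$, and $\widehat\Omega_f(\mu)$ its $p$-adic completion. Put $\omega_{\mathbf u}=\mathbf x^{\mathbf u}/f$ for $\mathbf u\in\mu_{\mathbb Z}$. Let $\sigma$ be a Frobenius lift on $R$ (a ring endomorphism with $\sigma(r)\equiv r^p \bmod p$), let $f^\sigma$ be $f$ with $\sigma$ applied to its coefficients, and $\omega^\sigma_{\mathbf u}=\mathbf x^{\mathbf u}/f^\sigma$. The Cartier operator $\mathscr C_p:\widehat\Omega_f(\mu)\to\widehat\Omega_{f^\sigma}(\mu)$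 is the $R$-linear map given on generators by the $p$-adically convergent series $$\mathscr C_p\Big((k-1)!\frac{g}{f^k}\Big)=(k-1)!\sum_{r\ge0}\binom{-k}{r}\frac{\mathscr C_p\big(g f^{(p-1)k}(f^p-f^\sigma(\mathbf x^p))^r\big)}{(f^\sigma)^{k+r}},$$ where $\mathscr C_p(\sum a_{\mathbf k}\mathbf x^{\mathbf k})=\sum a_{p\mathbf k}\mathbf x^{\mathbf k}$ on Laurent polynomials; likewise for $f^{\sigma^s}$ in place of $f$. Put $$U_f(\mu)=\{\omega\in\widehat\Omega_f(\mu) : \mathscr C_p^s(\omega)\in p^s\widehat\Omega_{f^{\sigma^s}}(\mu)\ \text{for all } s\ge1\}.$$ Let $|\cdot|_t$ be a (real-valued, multiplicative) non-archimedean absolute value on $R$, and let $S$ be the completion of $R$ with respect to it. Assume that $\bigcap_s p^sS=\{0\}$ and that $|a|_t<|b|_t$ implies $|\sigma(a)|_t<|\sigma(b)|_t$ for $a,b\in R$; then $\sigma$ extends continuously to $S$. Let $\delta$ be a derivation of $R$ that is continuous for $|\cdot|_t$, and extend it continuously to $S$. Let $\mathbf v\in\mathbb Z^n$ be such that $|v_{\mathbf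 v}|_t>|v_{\mathbf w}|_t$ for all $\mathbf w\ne\mathbf v$ and $v_{\mathbf v}\in S^\times$. For $\omega=g/f^k$ let $p_{\mathbf v}(\omega)\in S$ be the constant term of the $t$-adically convergent Laurent expansion $$v_{\mathbf v}^{-k}\,g\,\mathbf x^{-k\mathbf v}\sum_{r\ge0}\binom{-k}{r}\Big(\sum_{\mathbf w\ne\mathbf v}\frac{v_{\mathbf w}}{v_{\mathbf v}}\mathbf x^{\mathbf w-\mathbf v}\Big)^r ,$$ and let $\mathbf p_{\mathbf v}\in S^h$ be the column vector with components $p_{\mathbf v}(\omega_{\mathbf u})$, $\mathbf u\in\mu_{\mathbb Z}$. **Theorem.** Assume that the Hasse–Witt matrix $\beta_p(\mu)=\big(\text{coefficient of }\mathbf x^{p\mathbf w-\mathbf u}\text{ in } f^{p-1}\big)_{\mathbf u,\mathbf w\in\mu_{\mathbb Z}}$ is invertible over $R$. Then the Cartier operators $\mathscr C_p:\widehat\Omega_{f^{\sigma^s}}(\mu)\to\widehat\Omega_{f^{\sigma^{s+1}}}(\mu)$, $s\ge0$, exist and are unique, and there are unique matrices $\Lambda_\sigma,N_\delta\in R^{h\times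 h}$ such that for all $\mathbf u\in\mu_{\mathbb Z}$ $$\mathscr C_p(\omega_{\mathbf u})\equiv\sum_{\mathbf w\in\mu_{\mathbb Z}}(\Lambda_\sigma)_{\mathbf u,\mathbf w}\,\omega^\sigma_{\mathbf w}\bmod U_{f^\sigma}(\mu),\qquad \delta(\omega_{\mathbf u})\equiv\sum_{\mathbf w\in\mu_{\mathbb Z}}(N_\delta)_{\mathbf u,\mathbf w}\,\omega_{\mathbf w}\bmod U_f(\mu).$$ Moreover $$\mathbf p_{\mathbf v}=\Lambda_\sigma\,\sigma(\mathbf p_{\mathbf v})\qquad\text{and}\qquad \delta(\mathbf p_{\mathbf v})=N_\delta\,\mathbf p_{\mathbf v}.$$ -/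

import Mathlib

open scoped Pointwise

noncomputable section

namespace DworkCrystal

/-! ### Laurent polynomials, Newton polytopes, open subsets -/

/-- Laurent polynomials `R[x₁^±1, …, xₙ^±1]`; `f.coeff u` is the coefficient of `x^u`. -/
abbrev Laurent (R : Type*) [CommRing R] (n : ℕ) : Type _ := AddMonoidAlgebra R (Fin n → ℤ)

/-- The monomial `c x^u`. -/
def mono {R : Type*} [CommRing R] {n : ℕ} (u : Fin n → ℤ) (c : R) : Laurent R n :=
  AddMonoidAlgebra.single u c

/-- A lattice point seen as a point of `ℝⁿ`. -/
def toReal {n : ℕ} (u : Fin n → ℤ) : Fin n → ℝ := fun i => (u i : ℝ)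

/-- The Newton polytope `Δ` of `f`. -/
def newton {R : Type*} [CommRing R] {n : ℕ} (f : Laurent R n) : Set (Fin n → ℝ) :=
  convexHull ℝ (toReal '' (f.coeff.support : Set (Fin n → ℤ)))

/-- `μ ⊆ Δ` is open: the complement `Δ \ μ` is a union of faces of `Δ`. -/
def IsOpenIn {n : ℕ} (Δ μ : Set (Fin n → ℝ)) : Prop :=
  μ ⊆ Δ ∧ ∃ 𝓕 : Set (Set (Fin n → ℝ)), (∀ F ∈ 𝓕, IsExposed ℝ Δ F) ∧ Δ \ μ = ⋃₀ 𝓕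

theorem finite_newton_lattice {R : Type*} [CommRing R] {n : ℕ} (f : Laurent R n)
    (μ : Set (Fin n → ℝ)) : {u : Fin n → ℤ | toReal u ∈ newton f ∧ toReal u ∈ μ}.Finite := by
  have hb : Bornology.IsBounded (newton f) :=
    isBounded_convexHull.2 ((f.coeff.support.finite_toSet.image toReal).isBounded)
  obtain ⟨M, hM⟩ := hb.exists_norm_le
  refine (Set.finite_Icc (fun _ : Fin n => -⌈M⌉) (fun _ => ⌈M⌉)).subset ?_
  rintro u ⟨hu, -⟩
  have h1 : ∀ i, |(u i : ℝ)| ≤ M := fun i => (norm_le_pi_norm (toReal u) i).trans (hM _ hu)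
  refine ⟨fun i => ?_, fun i => ?_⟩
  · have h2 := (abs_le.1 (h1 i)).1
    have h3 := Int.le_ceil M
    have : ((-⌈M⌉ : ℤ) : ℝ) ≤ (u i : ℝ) := by push_cast; linarith
    exact_mod_cast this
  · have : ((u i : ℤ) : ℝ) ≤ (⌈M⌉ : ℝ) := (abs_le.1 (h1 i)).2.trans (Int.le_ceil M)
    exact_mod_cast this

/-- `μ_ℤ`, the finite set of lattice points of `μ ⊆ Δ`. -/
def latticePts {R : Type*} [CommRing R] {n : ℕ} (f : Laurent R n) (μ : Set (Fin n → ℝ)) :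
    Finset (Fin n → ℤ) :=
  (finite_newton_lattice f μ).toFinset

theorem toReal_mem {R : Type*} [CommRing R] {n : ℕ} {f : Laurent R n} {μ : Set (Fin n → ℝ)}
    (u : latticePts f μ) : toReal u.1 ∈ μ :=
  ((finite_newton_lattice f μ).mem_toFinset.1 u.2).2

/-- The Hasse–Witt matrix `β_p(μ)`: its `(u, v)` entry is the coefficient of `x^(p v - u)` in
`f^(p-1)`. -/
def hasseWitt {R : Type*} [CommRing R] {n : ℕ} (p : ℕ) (f : Laurent R n) (μ : Set (Fin n → ℝ)) :
    Matrix (latticePts f μ) (latticePts f μ) R :=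
  fun u v => (f ^ (p - 1)).coeff (p • v.1 - u.1)

/-! ### Frobenius lifts, derivations and the Cartier operation on Laurent polynomials -/

/-- `σ` is a Frobenius lift: `σ r ≡ r ^ p` modulo `p`. -/
def IsFrobeniusLift {R : Type*} [CommRing R] (p : ℕ) (σ : R →+* R) : Prop :=
  ∀ r : R, (p : R) ∣ σ r - r ^ p

/-- `f ↦ f^σ`, applying `σ` to the coefficients. -/
def twist {R : Type*} [CommRing R] {n : ℕ} (σ : R →+* R) (f : Laurent R n) : Laurent R n :=
  AddMonoidAlgebra.mapRingHom (Fin n → ℤ) σ f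

/-- `f^(σ^s)`. -/
def twistIter {R : Type*} [CommRing R] {n : ℕ} (σ : R →+* R) : ℕ → Laurent R n → Laurent R n
  | 0, f => f
  | s + 1, f => twistIter σ s (twist σ f)

/-- A derivation `δ` of `R` applied to the coefficients of a Laurent polynomial. -/
def coeffDeriv {R : Type*} [CommRing R] {n : ℕ} (δ : Derivation ℤ R R) (f : Laurent R n) :
    Laurent R n :=
  AddMonoidAlgebra.ofCoeff (f.coeff.mapRange δ (map_zero δ))

/-- The substitution `x ↦ x^p`. -/
def substPow {R : Type*} [CommRing R] {n : ℕ} (p : ℕ) (f : Laurent R n) : Laurent R n :=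
  AddMonoidAlgebra.mapDomain (fun u : Fin n → ℤ => p • u) f

/-- The Cartier operation `∑ a_k x^k ↦ ∑ a_{pk} x^k` on Laurent polynomials. -/
def cartierPoly {R : Type*} [CommRing R] {n : ℕ} (p : ℕ) (g : Laurent R n) : Laurent R n :=
  ∑ k ∈ g.coeff.support.image (fun u i => u i / (p : ℤ)), mono k (g.coeff (p • k))

/-! ### The modules `Ω_f(μ)` and their `p`-adic completions -/

/-- The field of rational functions in `x₁, …, xₙ` over the fraction field of `R`. -/
abbrev RatFun (R : Type*) [CommRing R] (n : ℕ) : Type _ := FractionRing (Laurent R n)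

/-- The rational function `g / f ^ k`. -/
def frac {R : Type*} [CommRing R] [IsDomain R] {n : ℕ} (g f : Laurent R n) (k : ℕ) : RatFun R n :=
  algebraMap (Laurent R n) (RatFun R n) g / algebraMap (Laurent R n) (RatFun R n) f ^ k

/-- The support of `g` is contained in `k μ`. -/
def SuppIn {R : Type*} [CommRing R] {n : ℕ} (g : Laurent R n) (k : ℕ) (μ : Set (Fin n → ℝ)) :
    Prop :=
  ∀ u ∈ g.coeff.support, toReal u ∈ (k : ℝ) • μ

/-- `Ω_f(μ)`: the `R`-module generated by the rational functions `(k-1)! g / f ^ k` with `k ≥ 1` and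
`supp g ⊆ k μ`. -/
def Omega {R : Type*} [CommRing R] [IsDomain R] {n : ℕ} (f : Laurent R n)
    (μ : Set (Fin n → ℝ)) : Submodule R (RatFun R n) :=
  Submodule.span R {ω | ∃ (k : ℕ) (g : Laurent R n), 1 ≤ k ∧ SuppIn g k μ ∧
    ω = ((k - 1).factorial : R) • frac g f k}

/-- The `p`-adic completion of `Ω_f(μ)`. -/
abbrev OmegaHat {R : Type*} [CommRing R] [IsDomain R] {n : ℕ} (p : ℕ) (f : Laurent R n)
    (μ : Set (Fin n → ℝ)) : Type _ :=
  AdicCompletion (Ideal.span {(p : R)}) (Omega f μ)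

/-- The natural map from `Ω_f(μ)` to its completion. -/
def toHat {R : Type*} [CommRing R] [IsDomain R] {n : ℕ} (p : ℕ) (f : Laurent R n)
    (μ : Set (Fin n → ℝ)) : Omega f μ →ₗ[R] OmegaHat p f μ :=
  AdicCompletion.of (Ideal.span {(p : R)}) (Omega f μ)

/-- The submodule `p^s` times the completion of `Ω_f(μ)`. -/
def pPow {R : Type*} [CommRing R] [IsDomain R] {n : ℕ} (p : ℕ) (f : Laurent R n)
    (μ : Set (Fin n → ℝ)) (s : ℕ) : Submodule R (OmegaHat p f μ) :=
  (Ideal.span {(p : R)}) ^ s • (⊤ : Submodule R (OmegaHat p f μ))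

/-- For `u ∈ μ_ℤ` the rational function `x^u / F`, as an element of `Ω_F(μ)`.
It is used for `F = f` (giving `ω_u`) and for `F = f^σ` (giving `ω_u^σ`). -/
def omegaElt {R : Type*} [CommRing R] [IsDomain R] {n : ℕ} (F : Laurent R n)
    {μ : Set (Fin n → ℝ)} {u : Fin n → ℤ} (hu : toReal u ∈ μ) : Omega F μ :=
  ⟨frac (mono u 1) F 1, Submodule.subset_span ⟨1, mono u 1, le_rfl, by
    intro w hw
    have hw' : w = u := by
      by_contra h
      rw [Finsupp.mem_support_iff] at hw
      exact hw (by simp [mono, h])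
    subst hw'
    simpa using hu, by simp⟩⟩

/-! ### The Cartier operator -/

/-- The `r`-th term of the expansion of `𝒞_p (g / f ^ k)`.  Writing
`g / f^k = g f^((p-1)k) / (f^σ(x^p) + H)^k` with `H = f^p - f^σ(x^p) ∈ p R[x^±1]` and expanding
binomially in `H`, one has `𝒞_p (h / f^σ(x^p)^m) = 𝒞_p(h) / (f^σ)^m`. -/
def cartierTerm {R : Type*} [CommRing R] [IsDomain R] {n : ℕ} (p : ℕ) (σ : R →+* R)
    (f g : Laurent R n) (k r : ℕ) : RatFun R n :=
  ((-1 : R) ^ r * ((k + r - 1).choose r : R)) •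
    frac (cartierPoly p (g * f ^ ((p - 1) * k) * (f ^ p - substPow p (twist σ f)) ^ r))
      (twist σ f) (k + r)

/-- An `R`-linear map between the completions of `Ω_f(μ)` and `Ω_{f^σ}(μ)` is the Cartier operator
if it sends each generator `(k-1)! g / f^k` to the `p`-adically convergent sum of the terms above. -/
def IsCartier {R : Type*} [CommRing R] [IsDomain R] {n : ℕ} (p : ℕ) (σ : R →+* R)
    (f : Laurent R n) (μ : Set (Fin n → ℝ))
    (C : OmegaHat p f μ →ₗ[R] OmegaHat p (twist σ f) μ) : Prop :=
  ∀ (k : ℕ) (g : Laurent R n), 1 ≤ k → SuppIn g k μ →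
    ∀ ω : Omega f μ, (ω : RatFun R n) = ((k - 1).factorial : R) • frac g f k →
      ∀ s : ℕ, ∃ N₀ : ℕ, ∀ N ≥ N₀, ∃ η : Omega (twist σ f) μ,
        (η : RatFun R n) =
          ((k - 1).factorial : R) • ∑ r ∈ Finset.range N, cartierTerm p σ f g k r ∧
        C (toHat p f μ ω) - toHat p (twist σ f) μ η ∈ pPow p (twist σ f) μ s

open Classical in
/-- The Cartier operator `𝒞_p`, the unique linear map satisfying `IsCartier`. -/
def cartier {R : Type*} [CommRing R] [IsDomain R] {n : ℕ} (p : ℕ) (σ : R →+* R)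
    (f : Laurent R n) (μ : Set (Fin n → ℝ)) : OmegaHat p f μ →ₗ[R] OmegaHat p (twist σ f) μ :=
  if h : ∃ C, IsCartier p σ f μ C then h.choose else 0

/-- `𝒞_p^s`, from the completion of `Ω_f(μ)` to that of `Ω_{f^(σ^s)}(μ)`. -/
def cartierIter {R : Type*} [CommRing R] [IsDomain R] {n : ℕ} (p : ℕ) (σ : R →+* R)
    (μ : Set (Fin n → ℝ)) :
    (s : ℕ) → (f : Laurent R n) → OmegaHat p f μ →ₗ[R] OmegaHat p (twistIter σ s f) μ
  | 0, _ => LinearMap.id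
  | s + 1, f => (cartierIter p σ μ s (twist σ f)).comp (cartier p σ f μ)

/-- `U_f(μ)`: the `ω` with `𝒞_p^s ω ≡ 0` modulo `p^s` for all `s ≥ 1`. -/
def U {R : Type*} [CommRing R] [IsDomain R] {n : ℕ} (p : ℕ) (σ : R →+* R) (f : Laurent R n)
    (μ : Set (Fin n → ℝ)) : Submodule R (OmegaHat p f μ) :=
  ⨅ s : {s : ℕ // 1 ≤ s}, (pPow p (twistIter σ s.1 f) μ s.1).comap (cartierIter p σ μ s.1 f)

/-- The defining property of `Λ_σ`: for all `u ∈ μ_ℤ`,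
`𝒞_p ω_u ≡ ∑_w (Λ_σ)_{u,w} ω_w^σ` modulo `U_{f^σ}(μ)`. -/
def IsFrobeniusMatrix {R : Type*} [CommRing R] [IsDomain R] {n : ℕ} (p : ℕ) (σ : R →+* R)
    (f : Laurent R n) (μ : Set (Fin n → ℝ))
    (Λ : Matrix (latticePts f μ) (latticePts f μ) R) : Prop :=
  ∀ u : latticePts f μ,
    cartier p σ f μ (toHat p f μ (omegaElt f (toReal_mem u))) -
      ∑ w : latticePts f μ, Λ u w • toHat p (twist σ f) μ (omegaElt (twist σ f) (toReal_mem w))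
    ∈ U p σ (twist σ f) μ

/-- The defining property of `N_δ`: for all `u ∈ μ_ℤ`, `δ ω_u = - x^u δ(f) / f^2` lies in `Ω_f(μ)`
and `δ ω_u ≡ ∑_w (N_δ)_{u,w} ω_w` modulo `U_f(μ)`. -/
def IsConnectionMatrix {R : Type*} [CommRing R] [IsDomain R] {n : ℕ} (p : ℕ) (σ : R →+* R)
    (δ : Derivation ℤ R R) (f : Laurent R n) (μ : Set (Fin n → ℝ))
    (N : Matrix (latticePts f μ) (latticePts f μ) R) : Prop :=
  ∀ u : latticePts f μ, ∃ η : Omega f μ,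
    (η : RatFun R n) = frac (-(mono u.1 1 * coeffDeriv δ f)) f 2 ∧
    toHat p f μ η - ∑ w : latticePts f μ, N u w • toHat p f μ (omegaElt f (toReal_mem w))
    ∈ U p σ f μ

/-! ### Periods

The `t`-adic absolute value on `R` is a norm, and `S` is the completion of `R`. -/

/-- `S`, the completion of `R` for the `t`-adic absolute value. -/
abbrev Compl (R : Type*) [NormedCommRing R] : Type _ := UniformSpace.Completion R

/-- The canonical ring homomorphism `R → S`. -/
def toCompl (R : Type*) [NormedCommRing R] : R →+* Compl R := UniformSpace.Completion.coeRingHom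

/-- The Laurent polynomial `∑_{w ≠ v} (f_w / f_v) x^(w - v)` over `S`
(meaningful when `f_v` is a unit of `S`). -/
def smallPart {R : Type*} [NormedCommRing R] {n : ℕ} (f : Laurent R n) (v : Fin n → ℤ) :
    Laurent (Compl R) n :=
  ∑ w ∈ f.coeff.support.erase v,
    mono (w - v) (toCompl R (f.coeff w) * Ring.inverse (toCompl R (f.coeff v)))

/-- The coefficient of `x^m` in the `t`-adic Laurent expansion of `g / f^k` with respect to `v`,
`f_v^(-k) g x^(-k v) ∑_r binom(-k, r) (∑_{w ≠ v} (f_w / f_v) x^(w - v))^r`,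
where `binom(-k, r) = (-1)^r binom(k + r - 1, r)`. -/
def expansionCoeff {R : Type*} [NormedCommRing R] {n : ℕ} (f : Laurent R n) (v : Fin n → ℤ)
    (g : Laurent R n) (k : ℕ) (m : Fin n → ℤ) : Compl R :=
  Ring.inverse (toCompl R (f.coeff v)) ^ k *
    ∑' r : ℕ, (-1 : Compl R) ^ r * ((k + r - 1).choose r : Compl R) *
      (AddMonoidAlgebra.mapRingHom (Fin n → ℤ) (toCompl R) g * mono (-(k • v)) 1 *
        smallPart f v ^ r).coeff m

/-- The period map `p_v(g / f^k)`: the constant term of the expansion with respect to `v`. -/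
def periodMap {R : Type*} [NormedCommRing R] {n : ℕ} (f : Laurent R n) (v : Fin n → ℤ)
    (g : Laurent R n) (k : ℕ) : Compl R :=
  expansionCoeff f v g k 0

/-- The vector of periods `p_v(ω_u)`, `u ∈ μ_ℤ`. -/
def periodVec {R : Type*} [NormedCommRing R] {n : ℕ} (f : Laurent R n) (v : Fin n → ℤ)
    (μ : Set (Fin n → ℝ)) : latticePts f μ → Compl R :=
  fun u => periodMap f v (mono u.1 1) 1

/-- The continuous extension to `S` of a (uniformly continuous) map `R → R`. -/
def extend {R : Type*} [NormedCommRing R] (φ : R → R) : Compl R → Compl R :=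
  UniformSpace.Completion.map φ

end DworkCrystal

end

noncomputable section

namespace DworkCrystal

/-! ### Laurent polynomials -/

section LaurentAlgebra

variable {R : Type*} [CommRing R] {n : ℕ}

/-! The theorem combines a splitting of the completed module with an invariance of periods.

The Cartier operator comes first. Write `f^p = f^σ(x^p) + H` with `H` divisible by `p`, and expand
`A / f^(pm)` in powers of `H`. The factorials in the definition of `Ω_f(μ)` reduce the size of the
`r`-th term to `p^r / r!`, which tends to zero because `p` is odd. Raising the pole order changes
the partial sums by a null sequence (`nullSeq_cartierSum_mul_pow`), so the limit depends on the
rational function alone.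

Splitting: the completion is the direct sum of the simple poles `g / f` and `U_f(μ)`
(`Ordinary.existsUnique_coeffs`). Modulo `p`, `𝒞_p` maps everything to simple poles
(`exists_cartier_sub_simplePole_mem`) and acts on simple poles by the Hasse–Witt matrix
(`cartier_simplePole`). Surjectivity of that matrix allows any `x` to be corrected by a simple pole
until `𝒞_p^s` of the difference is divisible by `p^s` (`Ordinary.exists_approx`). Injectivity modulo
`p` pins the correction down modulo `p^s` (`Ordinary.eq_smul_of_cartierIter_mem`). The corrections
therefore converge, and to a unique limit. The matrices `Λ_σ` and `N_δ` are the coordinates of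
`𝒞_p(ω_u)` and `δ(ω_u)` in this splitting.

Invariance: a dominant coefficient makes `f` invertible in the completion of the Laurent polynomials
for the Gauss norm, so a period is the constant coefficient of an honest ring element. Since `𝒞_p`
keeps the exponents divisible by `p` and divides them by `p`, it fixes constant terms
(`Dominant.periodHat_comp_cartier`). The period of an element of `U_f(μ)` is thus divisible by every
`p^s`, hence zero (`Dominant.periodHat_eq_zero`). Taking periods of the two congruences gives the
two equations, because the constant coefficient commutes with `σ` and `δ`. -/

theorem laurent_induction {P : Laurent R n → Prop} (h0 : P 0)
    (hs : ∀ u c, P (mono u c)) (ha : ∀ x y, P x → P y → P (x + y)) (x : Laurent R n) : P x := by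
  suffices h : ∀ c : (Fin n → ℤ) →₀ R, P (AddMonoidAlgebra.ofCoeff c) from h x.coeff
  intro c
  induction c using Finsupp.induction_linear with
  | zero => exact h0
  | add x y hx hy => exact ha _ _ hx hy
  | single u r => exact hs u r

theorem coeff_mono (u w : Fin n → ℤ) (c : R) :
    (mono u c).coeff w = if u = w then c else 0 := by
  simp [mono, Finsupp.single_apply]

theorem mono_mul_mono (u w : Fin n → ℤ) (c d : R) :
    mono u c * mono w d = mono (u + w) (c * d) :=
  AddMonoidAlgebra.single_mul_single _ _ _ _

theorem mono_pow (u : Fin n → ℤ) (c : R) (k : ℕ) : mono u c ^ k = mono (k • u) (c ^ k) :=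
  AddMonoidAlgebra.single_pow _ _ _

theorem coeff_mul_mono (g : Laurent R n) (u w : Fin n → ℤ) (c : R) :
    (g * mono u c).coeff w = g.coeff (w - u) * c := by
  simp [mono, AddMonoidAlgebra.coeff_mul_single_apply, sub_eq_add_neg]

theorem coeff_mono_mul (g : Laurent R n) (u w : Fin n → ℤ) (c : R) :
    (mono u c * g).coeff w = c * g.coeff (w - u) := by
  simp [mono, AddMonoidAlgebra.coeff_single_mul_apply, sub_eq_add_neg, add_comm]

/-- The control of the support is what keeps the quotient inside the same `k μ`. -/
theorem exists_eq_smul (r : R) (g : Laurent R n) (h : ∀ u, r ∣ g.coeff u) :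
    ∃ g' : Laurent R n, g = r • g' ∧ g'.coeff.support ⊆ g.coeff.support := by
  choose q hq using h
  have hc : ∀ u, (∑ w ∈ g.coeff.support, mono w (q w)).coeff u =
      if u ∈ g.coeff.support then q u else 0 := by
    intro u
    rw [AddMonoidAlgebra.coeff_sum, Finsupp.finsetSum_apply]
    simp only [coeff_mono, Finset.sum_ite_eq']
  refine ⟨∑ w ∈ g.coeff.support, mono w (q w), ?_, ?_⟩
  · ext u
    rw [AddMonoidAlgebra.coeff_smul_apply, hc]
    split_ifs with hu
    · exact hq u
    · simpa using hu
  · intro u hu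
    rw [Finsupp.mem_support_iff, hc] at hu
    by_contra h'
    exact hu (if_neg h')

theorem natCast_dvd_iff (p : ℕ) (g : Laurent R n) :
    (p : Laurent R n) ∣ g ↔ ∀ u, (p : R) ∣ g.coeff u := by
  have hmul : ∀ h : Laurent R n, (p : Laurent R n) * h = (p : R) • h := fun h => by
    rw [← nsmul_eq_mul, Nat.cast_smul_eq_nsmul]
  constructor
  · rintro ⟨h, rfl⟩ u
    rw [hmul, AddMonoidAlgebra.coeff_smul_apply]
    exact dvd_mul_right _ _
  · intro h
    obtain ⟨g', hg, -⟩ := exists_eq_smul _ g h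
    exact ⟨g', by rw [hmul, hg]⟩

/-- Rounding down exponents not divisible by `p` only adds harmless indices to the defining sum:
each index occurs once, with its correct coefficient. -/
theorem coeff_cartierPoly {p : ℕ} (hp : p ≠ 0) (g : Laurent R n) (k : Fin n → ℤ) :
    (cartierPoly p g).coeff k = g.coeff (p • k) := by
  have hk : (fun i => (p • k) i / (p : ℤ)) = k := by
    funext i; simp [hp]
  rw [cartierPoly, AddMonoidAlgebra.coeff_sum, Finsupp.finsetSum_apply]
  simp only [coeff_mono, Finset.sum_ite_eq']
  split_ifs with h
  · rfl
  · by_contra h'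
    exact h (Finset.mem_image.2 ⟨p • k, Finsupp.mem_support_iff.2 (Ne.symm h'), hk⟩)

theorem cartierPoly_add {p : ℕ} (hp : p ≠ 0) (g h : Laurent R n) :
    cartierPoly p (g + h) = cartierPoly p g + cartierPoly p h := by
  ext k; simp [coeff_cartierPoly hp]

theorem cartierPoly_smul {p : ℕ} (hp : p ≠ 0) (r : R) (g : Laurent R n) :
    cartierPoly p (r • g) = r • cartierPoly p g := by
  ext k; simp [coeff_cartierPoly hp]

theorem substPow_eq (p : ℕ) (f : Laurent R n) :
    substPow p f = AddMonoidAlgebra.mapDomainRingHom R (nsmulAddMonoidHom p) f := rfl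

theorem substPow_mono (p : ℕ) (u : Fin n → ℤ) (c : R) :
    substPow p (mono u c) = mono (p • u) c := by
  simp [substPow, mono]

/-- Projection formula. For a monomial `F` both sides are the same shift of exponents. It is what
allows `f^σ(x^p)` in a denominator to leave `𝒞_p` as `f^σ`. -/
theorem cartierPoly_mul_substPow {p : ℕ} (hp : p ≠ 0) (A F : Laurent R n) :
    cartierPoly p (A * substPow p F) = cartierPoly p A * F := by
  induction F using laurent_induction with
  | h0 => ext k; simp [coeff_cartierPoly hp, substPow_eq]
  | hs u c =>
    ext k
    rw [coeff_cartierPoly hp, substPow_mono, coeff_mul_mono, coeff_mul_mono, coeff_cartierPoly hp,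
      smul_sub]
  | ha x y hx hy =>
    simp only [substPow_eq, map_add, mul_add] at *
    rw [cartierPoly_add hp, hx, hy]

theorem twist_mono (σ : R →+* R) (u : Fin n → ℤ) (c : R) : twist σ (mono u c) = mono u (σ c) := by
  simp [twist, mono]

theorem coeff_twist (σ : R →+* R) (f : Laurent R n) (u : Fin n → ℤ) :
    (twist σ f).coeff u = σ (f.coeff u) := by
  simp [twist]

/-- The defect `f ^ p - f^σ(x^p)` of the Frobenius lift. -/
def frobDefect (p : ℕ) (σ : R →+* R) (f : Laurent R n) : Laurent R n :=
  f ^ p - substPow p (twist σ f)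

/-- Both `f ^ p` and `f^σ(x^p)` are additive in `f` modulo `p`, so monomials suffice, where the
claim is the Frobenius lift property. -/
theorem dvd_frobDefect {p : ℕ} (hp : p.Prime) {σ : R →+* R} (hσ : IsFrobeniusLift p σ)
    (f : Laurent R n) : (p : Laurent R n) ∣ frobDefect p σ f := by
  unfold frobDefect
  induction f using laurent_induction with
  | h0 => simp [substPow_eq, twist, hp.ne_zero]
  | hs u c =>
    rw [twist_mono, substPow_mono, mono_pow, natCast_dvd_iff]
    intro w
    have := (dvd_neg (a := (p : R))).2 (hσ c)
    simp only [AddMonoidAlgebra.coeff_sub, Finsupp.sub_apply, coeff_mono]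
    split_ifs
    · simpa using this
    · simp
  | ha x y hx hy =>
    obtain ⟨r, hr⟩ := exists_add_pow_prime_eq hp x y
    have : (x + y) ^ p - substPow p (twist σ (x + y)) =
        (x ^ p - substPow p (twist σ x)) + (y ^ p - substPow p (twist σ y)) + p * (x * y * r) := by
      rw [hr]; simp only [substPow_eq, twist, map_add]; ring
    rw [this]
    exact dvd_add (dvd_add hx hy) (dvd_mul_right _ _)

theorem support_twist {σ : R →+* R} (hσ : Function.Injective σ) (f : Laurent R n) :
    (twist σ f).coeff.support = f.coeff.support := by
  ext u
  simp only [Finsupp.mem_support_iff, coeff_twist, ne_eq, map_eq_zero_iff σ hσ]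

theorem newton_twist {σ : R →+* R} (hσ : Function.Injective σ) (f : Laurent R n) :
    newton (twist σ f) = newton f := by
  rw [newton, support_twist hσ, newton]

theorem latticePts_twist {σ : R →+* R} (hσ : Function.Injective σ) (f : Laurent R n)
    (μ : Set (Fin n → ℝ)) : latticePts (twist σ f) μ = latticePts f μ := by
  simp only [latticePts, newton_twist hσ]

theorem twist_ne_zero {σ : R →+* R} (hσ : Function.Injective σ) {f : Laurent R n} (hf : f ≠ 0) :
    twist σ f ≠ 0 := by
  intro h
  apply hf
  ext u
  have := coeff_twist σ f u
  rw [h] at this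
  simpa using (map_eq_zero_iff σ hσ).1 this.symm

end LaurentAlgebra

/-! ### Supports -/

section Supports

variable {R : Type*} [CommRing R] {n : ℕ}

theorem toReal_add (u w : Fin n → ℤ) : toReal (u + w) = toReal u + toReal w := by
  funext i; simp [toReal]

theorem toReal_nsmul (p : ℕ) (u : Fin n → ℤ) : toReal (p • u) = (p : ℝ) • toReal u := by
  funext i; simp [toReal]

theorem suppIn_iff {g : Laurent R n} {k : ℕ} {μ : Set (Fin n → ℝ)} :
    SuppIn g k μ ↔ ∀ u, g.coeff u ≠ 0 → toReal u ∈ (k : ℝ) • μ := by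
  simp [SuppIn]

theorem SuppIn.add {g h : Laurent R n} {k : ℕ} {μ : Set (Fin n → ℝ)} (hg : SuppIn g k μ)
    (hh : SuppIn h k μ) : SuppIn (g + h) k μ := by
  rw [suppIn_iff] at *
  intro u hu
  by_cases h0 : g.coeff u = 0
  · exact hh u (by simpa [h0] using hu)
  · exact hg u h0

theorem SuppIn.smul {g : Laurent R n} {k : ℕ} {μ : Set (Fin n → ℝ)} (hg : SuppIn g k μ) (r : R) :
    SuppIn (r • g) k μ := by
  rw [suppIn_iff] at *
  intro u hu
  exact hg u fun h0 => hu (by simp [h0])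

theorem suppIn_zero (k : ℕ) (μ : Set (Fin n → ℝ)) : SuppIn (0 : Laurent R n) k μ := by
  simp [SuppIn]

theorem SuppIn.neg {g : Laurent R n} {k : ℕ} {μ : Set (Fin n → ℝ)} (hg : SuppIn g k μ) :
    SuppIn (-g) k μ := by
  simpa using hg.smul (-1)

theorem SuppIn.sub {g h : Laurent R n} {k : ℕ} {μ : Set (Fin n → ℝ)} (hg : SuppIn g k μ)
    (hh : SuppIn h k μ) : SuppIn (g - h) k μ := by
  rw [sub_eq_add_neg]; exact hg.add hh.neg

theorem SuppIn.mono_subset {g h : Laurent R n} {k : ℕ} {μ : Set (Fin n → ℝ)} (hg : SuppIn g k μ)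
    (hh : h.coeff.support ⊆ g.coeff.support) : SuppIn h k μ :=
  fun u hu => hg u (hh hu)

theorem suppIn_mono {u : Fin n → ℤ} {k : ℕ} {μ : Set (Fin n → ℝ)} (c : R)
    (hu : toReal u ∈ (k : ℝ) • μ) : SuppIn (mono u c) k μ := by
  rw [suppIn_iff]
  intro w hw
  rw [coeff_mono] at hw
  split_ifs at hw with h
  · exact h ▸ hu
  · exact absurd rfl hw

theorem suppIn_mul_of {g h : Laurent R n} {a b c : ℕ} {μ ν ξ : Set (Fin n → ℝ)}
    (hg : SuppIn g a μ) (hh : SuppIn h b ν) (hs : (a : ℝ) • μ + (b : ℝ) • ν ⊆ (c : ℝ) • ξ) :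
    SuppIn (g * h) c ξ := by
  classical
  intro u hu
  obtain ⟨x, hx, y, hy, rfl⟩ :=
    Finset.mem_add.1 (AddMonoidAlgebra.support_coeff_mul_subset g h hu)
  exact hs (Set.mem_add.2 ⟨_, hg x hx, _, hh y hy, (toReal_add x y).symm⟩)

theorem convex_newton (f : Laurent R n) : Convex ℝ (newton f) := convex_convexHull _ _

/-- A convex combination giving positive weight to a point `x` of `μ` cannot lie on a removed face:
a linear functional maximal at the combination would be maximal at `x` too. The condition `1 ≤ a`
provides the positive weight. -/
theorem IsOpenIn.smul_add_smul {Δ μ : Set (Fin n → ℝ)} (hμ : IsOpenIn Δ μ) (hΔ : Convex ℝ Δ)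
    {a b : ℕ} (ha : 1 ≤ a) : (a : ℝ) • μ + (b : ℝ) • Δ ⊆ ((a + b : ℕ) : ℝ) • μ := by
  obtain ⟨hsub, 𝓕, hF, hU⟩ := hμ
  rintro _ ⟨_, ⟨x, hx, rfl⟩, _, ⟨y, hy, rfl⟩, rfl⟩
  have ha' : (0 : ℝ) < a := by exact_mod_cast ha
  have hb' : (0 : ℝ) ≤ b := by positivity
  have hs : (0 : ℝ) < a + b := by positivity
  have hz : (a / (a + b) : ℝ) • x + (b / (a + b) : ℝ) • y ∈ Δ :=
    hΔ (hsub hx) hy (by positivity) (by positivity) (by field_simp)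
  refine Set.mem_smul_set.2 ⟨(a / (a + b) : ℝ) • x + (b / (a + b) : ℝ) • y, ?_, ?_⟩
  · by_contra hn
    have h1 := hU.subset ⟨hz, hn⟩
    obtain ⟨F, hFm, hzF⟩ := h1
    -- The functional `l` exposes `F`, so it attains its maximum over `Δ` at the combination.
    obtain ⟨l, hl⟩ := hF F hFm ⟨_, hzF⟩
    have hz2 : ∀ w ∈ Δ, l w ≤ l ((a / (a + b) : ℝ) • x + (b / (a + b) : ℝ) • y) := by
      rw [hl] at hzF; exact hzF.2
    have hxF : x ∈ F := by
      rw [hl]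
      refine ⟨hsub hx, fun w hw => (hz2 w hw).trans ?_⟩
      have hxz := hz2 x (hsub hx)
      have hyz := hz2 y hy
      simp only [map_add, map_smul, smul_eq_mul] at *
      have e : (a / (a + b) : ℝ) + b / (a + b) = 1 := by field_simp
      have hbs : (0 : ℝ) ≤ b / (a + b) := by positivity
      have has : (0 : ℝ) < a / (a + b) := by positivity
      generalize (a / (a + b) : ℝ) = s at *
      generalize (b / (a + b) : ℝ) = t at *
      obtain rfl : s = 1 - t := by linarith
      have : l y ≤ l x := le_of_mul_le_mul_left (by linarith) has
      nlinarith
    have : x ∈ Δ \ μ := hU ▸ ⟨F, hFm, hxF⟩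
    exact this.2 hx
  · push_cast
    rw [smul_add, smul_smul, smul_smul]
    congr 2 <;> field_simp

theorem suppIn_self (f : Laurent R n) : SuppIn f 1 (newton f) := by
  intro u hu
  rw [Nat.cast_one, one_smul]
  exact subset_convexHull ℝ _ ⟨u, hu, rfl⟩

theorem SuppIn.mul_newton {Δ : Set (Fin n → ℝ)} (hΔ : Convex ℝ Δ) {g h : Laurent R n} {a b : ℕ}
    (hg : SuppIn g a Δ) (hh : SuppIn h b Δ) : SuppIn (g * h) (a + b) Δ := by
  refine suppIn_mul_of hg hh ?_
  rw [Nat.cast_add, hΔ.add_smul (by positivity) (by positivity)]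

theorem newton_nonempty {f : Laurent R n} (hf : f ≠ 0) : (newton f).Nonempty := by
  rw [newton, convexHull_nonempty_iff, Set.image_nonempty, Finset.coe_nonempty,
    Finsupp.support_nonempty_iff]
  simpa using hf

theorem suppIn_one {Δ : Set (Fin n → ℝ)} (hΔ : Δ.Nonempty) : SuppIn (1 : Laurent R n) 0 Δ := by
  refine suppIn_mono 1 ?_
  rw [Nat.cast_zero, Set.zero_smul_set hΔ, Set.mem_zero]
  funext i; simp [toReal]

theorem SuppIn.pow_newton {Δ : Set (Fin n → ℝ)} (hΔ : Convex ℝ Δ) (hn : Δ.Nonempty)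
    {g : Laurent R n} {a : ℕ} (hg : SuppIn g a Δ) (k : ℕ) : SuppIn (g ^ k) (a * k) Δ := by
  induction k with
  | zero => simpa using suppIn_one hn
  | succ k ih => rw [pow_succ, Nat.mul_succ]; exact ih.mul_newton hΔ hg

theorem SuppIn.mul_open {Δ μ : Set (Fin n → ℝ)} (hμ : IsOpenIn Δ μ) (hΔ : Convex ℝ Δ)
    {g h : Laurent R n} {a b : ℕ} (ha : 1 ≤ a) (hg : SuppIn g a μ) (hh : SuppIn h b Δ) :
    SuppIn (g * h) (a + b) μ :=
  suppIn_mul_of hg hh (hμ.smul_add_smul hΔ ha)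

theorem SuppIn.cartierPoly {p : ℕ} (hp : p ≠ 0) {g : Laurent R n} {a : ℕ} {μ : Set (Fin n → ℝ)}
    (hg : SuppIn g (p * a) μ) : SuppIn (cartierPoly p g) a μ := by
  rw [suppIn_iff] at *
  intro u hu
  rw [coeff_cartierPoly hp] at hu
  have h := hg _ hu
  have hp' : (p : ℝ) ≠ 0 := by exact_mod_cast hp
  rwa [toReal_nsmul, Nat.cast_mul, mul_smul, Set.smul_mem_smul_set_iff₀ hp'] at h

theorem suppIn_frobDefect {p : ℕ} {σ : R →+* R} {f : Laurent R n} (hf : f ≠ 0) :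
    SuppIn (frobDefect p σ f) p (newton f) := by
  classical
  refine SuppIn.sub ?_ ?_
  · simpa using (suppIn_self f).pow_newton (convex_newton f) (newton_nonempty hf) p
  · intro u hu
    obtain ⟨w, hw, rfl⟩ := Finset.mem_image.1 (Finsupp.mapDomain_support hu)
    rw [toReal_nsmul]
    refine Set.smul_mem_smul_set (subset_convexHull ℝ _ ⟨w, ?_, rfl⟩)
    rw [Finset.mem_coe, Finsupp.mem_support_iff, coeff_twist] at *
    exact fun h => hw (by rw [h, map_zero])

theorem suppIn_coeffDeriv (δ : Derivation ℤ R R) (f : Laurent R n) :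
    SuppIn (coeffDeriv δ f) 1 (newton f) :=
  (suppIn_self f).mono_subset (Finsupp.support_mapRange (hf := map_zero δ))

theorem mem_latticePts {f : Laurent R n} {μ : Set (Fin n → ℝ)} (hμ : IsOpenIn (newton f) μ)
    (u : Fin n → ℤ) : u ∈ latticePts f μ ↔ toReal u ∈ μ := by
  rw [latticePts, Set.Finite.mem_toFinset]
  exact ⟨fun h => h.2, fun h => ⟨hμ.1 h, h⟩⟩

end Supports

/-! ### Completions for a principal ideal -/

section Completion

variable {R : Type*} [CommRing R] {a : R} {M N : Type*} [AddCommGroup M] [Module R M]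
  [AddCommGroup N] [Module R N]

theorem mem_span_pow_smul_top_iff {s : ℕ} {x : M} :
    x ∈ (Ideal.span {a} ^ s • ⊤ : Submodule R M) ↔ ∃ y, x = a ^ s • y := by
  rw [Ideal.span_singleton_pow, Submodule.ideal_span_singleton_smul,
    Submodule.mem_smul_pointwise_iff_exists]
  simp [eq_comm]

theorem smul_pow_mem {s : ℕ} (y : M) : a ^ s • y ∈ (Ideal.span {a} ^ s • ⊤ : Submodule R M) :=
  mem_span_pow_smul_top_iff.2 ⟨y, rfl⟩

theorem pow_smul_top_anti {s t : ℕ} (h : s ≤ t) :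
    (Ideal.span {a} ^ t • ⊤ : Submodule R M) ≤ Ideal.span {a} ^ s • ⊤ :=
  Submodule.smul_mono_left (Ideal.pow_le_pow_right h)

theorem map_mem_pow_smul_top (φ : M →ₗ[R] N) {s : ℕ} {x : M}
    (hx : x ∈ (Ideal.span {a} ^ s • ⊤ : Submodule R M)) :
    φ x ∈ (Ideal.span {a} ^ s • ⊤ : Submodule R N) := by
  obtain ⟨y, rfl⟩ := mem_span_pow_smul_top_iff.1 hx
  rw [map_smul]
  exact smul_pow_mem _

theorem smul_mem_pow_add {s t : ℕ} {x : M}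
    (hx : x ∈ (Ideal.span {a} ^ s • ⊤ : Submodule R M)) :
    a ^ t • x ∈ (Ideal.span {a} ^ (t + s) • ⊤ : Submodule R M) := by
  obtain ⟨y, rfl⟩ := mem_span_pow_smul_top_iff.1 hx
  rw [smul_smul, ← pow_add]
  exact smul_pow_mem _

/-- Cancellation of `a ^ t`, valid because multiplication by `a` is injective on `M`. -/
theorem mem_pow_of_smul_mem (hM : ∀ x : M, a • x = 0 → x = 0) {s t : ℕ} {x : M}
    (hx : a ^ t • x ∈ (Ideal.span {a} ^ (t + s) • ⊤ : Submodule R M)) :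
    x ∈ (Ideal.span {a} ^ s • ⊤ : Submodule R M) := by
  obtain ⟨y, hy⟩ := mem_span_pow_smul_top_iff.1 hx
  have hk : ∀ (k : ℕ) (z : M), a ^ k • z = 0 → z = 0 := by
    intro k
    induction k with
    | zero => intro z hz; simpa using hz
    | succ k ih => intro z hz; rw [pow_succ, mul_smul] at hz; exact hM _ (ih _ hz)
  have : x = a ^ s • y := by
    rw [← sub_eq_zero]
    refine hk t _ ?_
    rw [smul_sub, hy, smul_smul, ← pow_add, sub_self]
  rw [this]
  exact smul_pow_mem _

variable (a) in
theorem span_singleton_fg : (Ideal.span {a}).FG := ⟨{a}, by simp⟩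

theorem hat_mem_iff {s : ℕ} {x : AdicCompletion (Ideal.span {a}) M} :
    x ∈ (Ideal.span {a} ^ s • ⊤ : Submodule R (AdicCompletion (Ideal.span {a}) M)) ↔
      AdicCompletion.eval (Ideal.span {a}) M s x = 0 := by
  rw [AdicCompletion.pow_smul_top_eq_ker_eval (span_singleton_fg a), LinearMap.mem_ker]

theorem of_mem_iff {s : ℕ} {x : M} :
    AdicCompletion.of (Ideal.span {a}) M x ∈
      (Ideal.span {a} ^ s • ⊤ : Submodule R (AdicCompletion (Ideal.span {a}) M)) ↔
      x ∈ (Ideal.span {a} ^ s • ⊤ : Submodule R M) := by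
  rw [hat_mem_iff, AdicCompletion.eval_of, Submodule.mkQ_apply, Submodule.Quotient.mk_eq_zero]

theorem exists_sub_of_mem (x : AdicCompletion (Ideal.span {a}) M) (s : ℕ) :
    ∃ m : M, x - AdicCompletion.of (Ideal.span {a}) M m ∈
      (Ideal.span {a} ^ s • ⊤ : Submodule R (AdicCompletion (Ideal.span {a}) M)) := by
  obtain ⟨m, hm⟩ := Submodule.mkQ_surjective _ (AdicCompletion.eval (Ideal.span {a}) M s x)
  refine ⟨m, ?_⟩
  rw [hat_mem_iff, map_sub, AdicCompletion.eval_of, hm, sub_self]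

theorem eq_zero_of_forall_mem [IsHausdorff (Ideal.span {a}) M] {x : M}
    (hx : ∀ s : ℕ, x ∈ (Ideal.span {a} ^ s • ⊤ : Submodule R M)) : x = 0 :=
  IsHausdorff.haus ‹_› x fun s => by rw [SModEq.zero]; exact hx s

/-- An approximation `m` of `x` modulo `a^(s+1)` has `a • m` in `a^(s+1) M`, so `m` lies in `a^s M`
and `x` is divisible by every `a^s`. -/
theorem hat_torsionFree (hM : ∀ x : M, a • x = 0 → x = 0)
    (x : AdicCompletion (Ideal.span {a}) M) (hx : a • x = 0) : x = 0 := by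
  refine eq_zero_of_forall_mem (a := a) fun s => ?_
  obtain ⟨m, hm⟩ := exists_sub_of_mem x (s + 1)
  have h1 : AdicCompletion.of (Ideal.span {a}) M (a ^ 1 • m) ∈
      (Ideal.span {a} ^ (1 + s) • ⊤ : Submodule R (AdicCompletion (Ideal.span {a}) M)) := by
    have := Submodule.smul_mem _ (-a) hm
    rw [neg_smul, smul_sub, hx, zero_sub, neg_neg, ← map_smul] at this
    rwa [pow_one, add_comm]
  have h2 := of_mem_iff.2 (mem_pow_of_smul_mem hM (of_mem_iff.1 h1))
  have := Submodule.add_mem _ (pow_smul_top_anti (Nat.le_succ s) hm) h2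
  rwa [sub_add_cancel] at this

theorem exists_limit (m : ℕ → M) (hm : ∀ s : ℕ, ∃ N₀, ∀ N ≥ N₀,
      m (N + 1) - m N ∈ (Ideal.span {a} ^ s • ⊤ : Submodule R M)) :
    ∃ x : AdicCompletion (Ideal.span {a}) M, ∀ s : ℕ, ∃ N₀, ∀ N ≥ N₀,
      x - AdicCompletion.of (Ideal.span {a}) M (m N) ∈
        (Ideal.span {a} ^ s • ⊤ : Submodule R (AdicCompletion (Ideal.span {a}) M)) := by
  choose N₀ hN₀ using hm
  have hd : ∀ s k N, N₀ s ≤ N → m (N + k) - m N ∈ (Ideal.span {a} ^ s • ⊤ : Submodule R M) := by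
    intro s k N hN
    induction k with
    | zero => simp
    | succ k ih =>
      have := Submodule.add_mem _ (hN₀ s (N + k) (by omega)) ih
      rwa [sub_add_sub_cancel] at this
  -- Partial sums of the thresholds are monotone and dominate each threshold, which gives a
  -- subsequence that is Cauchy at the prescribed rate.
  let g : ℕ → ℕ := fun k => ∑ i ∈ Finset.range (k + 1), N₀ i
  have hg : ∀ k, N₀ k ≤ g k := fun k =>
    Finset.single_le_sum (fun _ _ => Nat.zero_le _) (Finset.self_mem_range_succ k)
  have hg' : ∀ k, g (k + 1) = g k + N₀ (k + 1) := fun k => Finset.sum_range_succ _ _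
  let c := AdicCompletion.AdicCauchySequence.mk (Ideal.span {a}) M (fun k => m (g k)) (by
    intro k
    rw [SModEq.comm, SModEq.sub_mem, hg']
    exact hd k _ _ (hg k))
  refine ⟨AdicCompletion.mk _ _ c, fun s => ⟨g s, fun N hN => ?_⟩⟩
  rw [hat_mem_iff, map_sub, AdicCompletion.eval_of, sub_eq_zero]
  obtain ⟨k, rfl⟩ := Nat.exists_eq_add_of_le hN
  change Submodule.Quotient.mk (m (g s)) = Submodule.Quotient.mk _
  rw [Submodule.Quotient.eq, ← neg_sub]
  exact Submodule.neg_mem _ (hd s k _ (hg s))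

/-- The functorial extension of `φ` lands in the completion of a completion, which is the completion
itself because the ideal is finitely generated. -/
theorem exists_hat_lift (φ : M →ₗ[R] AdicCompletion (Ideal.span {a}) N) :
    ∃ Φ : AdicCompletion (Ideal.span {a}) M →ₗ[R] AdicCompletion (Ideal.span {a}) N,
      ∀ m, Φ (AdicCompletion.of _ _ m) = φ m := by
  have := AdicCompletion.isAdicComplete (I := Ideal.span {a}) (M := N) (span_singleton_fg a)
  refine ⟨(AdicCompletion.ofLinearEquiv (Ideal.span {a})
    (AdicCompletion (Ideal.span {a}) N)).symm.toLinearMap ∘ₗ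
      (AdicCompletion.map (Ideal.span {a}) φ).restrictScalars R, fun m => ?_⟩
  refine (congrArg (AdicCompletion.ofLinearEquiv (Ideal.span {a})
    (AdicCompletion (Ideal.span {a}) N)).symm (AdicCompletion.map_of _ φ m)).trans ?_
  exact AdicCompletion.ofLinearEquiv_symm_of _ _

/-- Linear maps are automatically `a`-adically continuous, and the image of `M` is dense. -/
theorem hat_hom_ext [IsHausdorff (Ideal.span {a}) N]
    {Φ Ψ : AdicCompletion (Ideal.span {a}) M →ₗ[R] N}
    (h : ∀ m, Φ (AdicCompletion.of _ _ m) = Ψ (AdicCompletion.of _ _ m)) : Φ = Ψ := by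
  refine LinearMap.ext fun x => ?_
  rw [← sub_eq_zero]
  refine eq_zero_of_forall_mem (a := a) fun s => ?_
  obtain ⟨m, hm⟩ := exists_sub_of_mem x s
  have := map_mem_pow_smul_top (Φ - Ψ) hm
  rwa [map_sub, LinearMap.sub_apply, LinearMap.sub_apply, h, sub_self, sub_zero] at this

end Completion

/-! ### Divisibility by factorials -/

section Arithmetic

/-- Legendre's bound `(p - 1) v_p(m!) < m` with `p - 1 ≥ 2`. The factor two gained from odd `p`
makes `p^m / m!` tend to zero. -/
theorem two_mul_padicValNat_factorial_le {p : ℕ} (hp : p.Prime) (hp2 : p ≠ 2) (m : ℕ) :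
    2 * padicValNat p m.factorial ≤ m - 1 := by
  have : Fact p.Prime := ⟨hp⟩
  rcases eq_or_ne m 0 with rfl | hm
  · simp
  · have h := sub_one_mul_padicValNat_factorial_lt_of_ne_zero p hm
    have h2 : 2 ≤ p - 1 := by have := hp.two_le; omega
    have := Nat.mul_le_mul_right (padicValNat p m.factorial) h2
    omega

/-- The multiples `p, 2p, …, jp` already contribute the divisor. -/
theorem pow_mul_factorial_dvd {p : ℕ} (hp : 0 < p) (j : ℕ) :
    p ^ j * j.factorial ∣ (p * j).factorial := by
  induction j with
  | zero => simp
  | succ j ih =>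
    have e : p * (j + 1) = (p * j + (p - 1)) + 1 := by rw [Nat.mul_succ]; omega
    have h2 := ih.trans (Nat.factorial_dvd_factorial (Nat.le_add_right (p * j) (p - 1)))
    calc p ^ (j + 1) * (j + 1).factorial = (p * (j + 1)) * (p ^ j * j.factorial) := by
          rw [Nat.factorial_succ]; ring
      _ ∣ (p * (j + 1)) * (p * j + (p - 1)).factorial := Nat.mul_dvd_mul_left _ h2
      _ = (p * (j + 1)).factorial := by rw [e, Nat.factorial_succ]

variable {R : Type*} [CommRing R] {p : ℕ} [IsAdicComplete (Ideal.span {(p : R)}) R]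

/-- Completeness puts `p` in the Jacobson radical, and a Bézout relation exhibits a multiple of `q`
as `1` minus a multiple of `p`. Divisibility by integers in `R` is thereby reduced to `p`-adic
valuations. -/
theorem isUnit_natCast_of_coprime {q : ℕ} (hq : p.Coprime q) : IsUnit (q : R) := by
  have hj : (p : R) ∈ (⊥ : Ideal R).jacobson :=
    IsAdicComplete.le_jacobson_bot (Ideal.span {(p : R)}) (Ideal.mem_span_singleton_self _)
  obtain ⟨u, w, h⟩ := (Nat.isCoprime_iff_coprime.2 hq).map (Int.castRingHom R)
  simp only [eq_intCast, Int.cast_natCast] at h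
  have h1 := Ideal.mem_jacobson_bot.1 hj (-u)
  have h2 : (p : R) * -u + 1 = w * q := by rw [← h]; ring
  rw [h2] at h1
  exact isUnit_of_mul_isUnit_right h1

theorem natCast_dvd_prime_pow (hp : p.Prime) {c j : ℕ} (hc : c ≠ 0) (h : padicValNat p c ≤ j) :
    (c : R) ∣ (p : R) ^ j := by
  rw [← Nat.ordProj_mul_ordCompl_eq_self c p, Nat.cast_mul, Nat.cast_pow]
  refine (isUnit_natCast_of_coprime (Nat.coprime_ordCompl hp hc)).mul_right_dvd.2 ?_
  exact pow_dvd_pow _ (by rwa [Nat.factorization_def c hp])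

theorem factorial_dvd_pow (hp : p.Prime) (hp2 : p ≠ 2) (r : ℕ) :
    (r.factorial : R) ∣ (p : R) ^ r := by
  refine natCast_dvd_prime_pow hp r.factorial_ne_zero ?_
  have := two_mul_padicValNat_factorial_le hp hp2 r
  omega

theorem prime_mul_factorial_dvd_pow (hp : p.Prime) (hp2 : p ≠ 2) {r : ℕ} (hr : 1 ≤ r) :
    (p : R) * (r.factorial : R) ∣ (p : R) ^ r := by
  obtain ⟨r, rfl⟩ := Nat.exists_eq_add_of_le' hr
  rw [pow_succ']
  refine mul_dvd_mul_left _ (natCast_dvd_prime_pow hp (r + 1).factorial_ne_zero ?_)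
  have := two_mul_padicValNat_factorial_le hp hp2 (r + 1)
  omega

theorem exists_pow_mul_factorial_dvd (hp : p.Prime) (hp2 : p ≠ 2) {c : ℕ} (hc : c ≠ 0) (s : ℕ) :
    ∃ N₀, ∀ N ≥ N₀, (p : R) ^ s * (c * N.factorial : ℕ) ∣ (p : R) ^ N := by
  have : Fact p.Prime := ⟨hp⟩
  -- At most half of the exponent `N` is used by `N!`; the other half must cover `s` and the
  -- valuation of `c`.
  refine ⟨2 * (s + padicValNat p c), fun N hN => ?_⟩
  have h := two_mul_padicValNat_factorial_le hp hp2 N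
  obtain ⟨k, rfl⟩ := Nat.exists_eq_add_of_le (show s ≤ N by omega)
  rw [pow_add]
  refine mul_dvd_mul_left _
    (natCast_dvd_prime_pow hp (mul_ne_zero hc (s + k).factorial_ne_zero) ?_)
  rw [padicValNat.mul hc (s + k).factorial_ne_zero]
  omega

end Arithmetic

/-! ### Rational functions and the modules `Ω_f(μ)` -/

section Omega

set_option linter.unusedSectionVars false

variable {R : Type*} [CommRing R] [IsDomain R] {n : ℕ}

theorem algebraMap_ratFun_ne_zero {f : Laurent R n} (hf : f ≠ 0) :
    algebraMap (Laurent R n) (RatFun R n) f ≠ 0 :=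
  (map_ne_zero_iff _ (IsFractionRing.injective _ _)).2 hf

theorem frac_add (g h f : Laurent R n) (k : ℕ) : frac (g + h) f k = frac g f k + frac h f k := by
  rw [frac, map_add, add_div, frac, frac]

theorem frac_smul (r : R) (g f : Laurent R n) (k : ℕ) : frac (r • g) f k = r • frac g f k := by
  have h : algebraMap (Laurent R n) (RatFun R n) (r • g) =
      r • algebraMap (Laurent R n) (RatFun R n) g := by
    rw [Algebra.algebraMap_eq_smul_one, smul_assoc, ← Algebra.algebraMap_eq_smul_one]
  rw [frac, frac, h, smul_div_assoc]

theorem frac_zero (f : Laurent R n) (k : ℕ) : frac 0 f k = 0 := by simp [frac]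

theorem frac_mul_pow {f : Laurent R n} (hf : f ≠ 0) (g : Laurent R n) (k j : ℕ) :
    frac (g * f ^ j) f (k + j) = frac g f k := by
  have := algebraMap_ratFun_ne_zero hf
  rw [frac, frac, map_mul, map_pow, pow_add, mul_div_mul_right _ _ (pow_ne_zero _ this)]

theorem frac_eq_iff {f : Laurent R n} (hf : f ≠ 0) {g h : Laurent R n} {k l : ℕ} :
    frac g f k = frac h f l ↔ g * f ^ l = h * f ^ k := by
  have := algebraMap_ratFun_ne_zero hf
  rw [frac, frac, div_eq_div_iff (pow_ne_zero _ this) (pow_ne_zero _ this), ← map_pow, ← map_pow,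
    ← map_mul, ← map_mul, (IsFractionRing.injective (Laurent R n) (RatFun R n)).eq_iff]

theorem factorial_smul_frac_mem {f g : Laurent R n} {μ : Set (Fin n → ℝ)} {k : ℕ} (hk : 1 ≤ k)
    (hg : SuppIn g k μ) : ((k - 1).factorial : R) • frac g f k ∈ Omega f μ :=
  Submodule.subset_span ⟨k, g, hk, hg, rfl⟩

theorem frac_one_mem {f g : Laurent R n} {μ : Set (Fin n → ℝ)} (hg : SuppIn g 1 μ) :
    frac g f 1 ∈ Omega f μ := by
  simpa using factorial_smul_frac_mem (f := f) le_rfl hg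

/-- The conditions on `f` and `μ` under which the theory is developed. -/
structure Admissible (μ : Set (Fin n → ℝ)) (f : Laurent R n) : Prop where
  ne_zero : f ≠ 0
  isOpen : IsOpenIn (newton f) μ

theorem Admissible.twisted {μ : Set (Fin n → ℝ)} {f : Laurent R n} (hf : Admissible μ f)
    {σ : R →+* R} (hσ : Function.Injective σ) : Admissible μ (twist σ f) :=
  ⟨twist_ne_zero hσ hf.ne_zero, by rw [newton_twist hσ]; exact hf.isOpen⟩

theorem Admissible.suppIn_mul {μ : Set (Fin n → ℝ)} {f : Laurent R n} (hf : Admissible μ f)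
    {g h : Laurent R n} {a b c : ℕ} (ha : 1 ≤ a) (hg : SuppIn g a μ) (hh : SuppIn h b (newton f))
    (hc : a + b = c) : SuppIn (g * h) c μ :=
  hc ▸ hg.mul_open hf.isOpen (convex_newton f) ha hh

theorem Admissible.suppIn_pow {μ : Set (Fin n → ℝ)} {f : Laurent R n} (hf : Admissible μ f)
    (k : ℕ) : SuppIn (f ^ k) k (newton f) := by
  simpa using (suppIn_self f).pow_newton (convex_newton f) (newton_nonempty hf.ne_zero) k

theorem Admissible.suppIn_mul_pow {μ : Set (Fin n → ℝ)} {f : Laurent R n} (hf : Admissible μ f)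
    {g : Laurent R n} {a b c : ℕ} (ha : 1 ≤ a) (hg : SuppIn g a μ) (hc : a + b = c) :
    SuppIn (g * f ^ b) c μ :=
  hf.suppIn_mul ha hg (hf.suppIn_pow b) hc

/-- Every element of `Ω_f(μ)` is of the form `g / f ^ k` with `k` arbitrarily large. -/
theorem Admissible.exists_frac {μ : Set (Fin n → ℝ)} {f : Laurent R n} (hf : Admissible μ f)
    {ω : RatFun R n} (hω : ω ∈ Omega f μ) :
    ∃ k₀, ∀ k ≥ k₀, ∃ g : Laurent R n, SuppIn g k μ ∧ ω = frac g f k := by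
  induction hω using Submodule.span_induction with
  | mem x hx =>
    obtain ⟨k, g, hk, hg, rfl⟩ := hx
    refine ⟨k, fun j hj => ?_⟩
    obtain ⟨i, rfl⟩ := Nat.exists_eq_add_of_le hj
    refine ⟨((k - 1).factorial : R) • (g * f ^ i), (hf.suppIn_mul_pow hk hg rfl).smul _, ?_⟩
    rw [frac_smul, frac_mul_pow hf.ne_zero]
  | zero => exact ⟨0, fun k _ => ⟨0, suppIn_zero _ _, (frac_zero _ _).symm⟩⟩
  | add x y _ _ hx hy =>
    obtain ⟨k₁, h₁⟩ := hx
    obtain ⟨k₂, h₂⟩ := hy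
    refine ⟨max k₁ k₂, fun k hk => ?_⟩
    obtain ⟨g₁, hg₁, e₁⟩ := h₁ k (le_of_max_le_left hk)
    obtain ⟨g₂, hg₂, e₂⟩ := h₂ k (le_of_max_le_right hk)
    exact ⟨g₁ + g₂, hg₁.add hg₂, by rw [frac_add, e₁, e₂]⟩
  | smul r x _ hx =>
    obtain ⟨k₁, h₁⟩ := hx
    refine ⟨k₁, fun k hk => ?_⟩
    obtain ⟨g, hg, e⟩ := h₁ k hk
    exact ⟨r • g, hg.smul r, by rw [frac_smul, e]⟩

theorem omega_torsionFree {p : ℕ} (hp : p ≠ 0) [CharZero R] {μ : Set (Fin n → ℝ)}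
    {f : Laurent R n} (x : Omega f μ) (hx : (p : R) • x = 0) : x = 0 := by
  have hp' : (p : R) ≠ 0 := Nat.cast_ne_zero.2 hp
  have h : (p : R) • (x : RatFun R n) = (p : R) • 0 := by
    rw [smul_zero, ← Submodule.coe_smul, hx, Submodule.coe_zero]
  exact Subtype.ext (smul_right_injective _ hp' h)

end Omega

/-! ### The binomial expansion of the Cartier operator -/

/-- This is `(1 + T) (1 + T)^(-(m+1)) = (1 + T)^(-m)`, truncated, with its boundary term; the proof
is Pascal's rule. Truncated subtraction gives the right values at `m = 0`, where only the term `r =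
0` survives. -/
theorem binomial_telescope {R M : Type*} [CommRing R] [AddCommGroup M] [Module R M] (y : ℕ → M)
    (m N : ℕ) :
    ∑ r ∈ Finset.range (N + 1), ((-1 : R) ^ r * ((m + 1 + r - 1).choose r : R)) • (y r + y (r + 1)) =
      ∑ r ∈ Finset.range (N + 1), ((-1 : R) ^ r * ((m + r - 1).choose r : R)) • y r +
        ((-1 : R) ^ N * ((m + N).choose N : R)) • y (N + 1) := by
  induction N with
  | zero => simp
  | succ N ih =>
    rw [Finset.sum_range_succ, ih, Finset.sum_range_succ _ (N + 1)]
    have e1 : m + 1 + (N + 1) - 1 = m + N + 1 := by omega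
    have e2 : m + (N + 1) - 1 = m + N := by omega
    have e3 : m + (N + 1) = m + N + 1 := by omega
    rw [e1, e2, e3, Nat.choose_succ_succ]
    push_cast
    module

section CartierSums

set_option linter.unusedSectionVars false

variable {R : Type*} [CommRing R] [IsDomain R] {n : ℕ}

/-- A Frobenius lift as in the main theorem: `p` is odd and `σ` is injective. -/
structure OddFrobenius (p : ℕ) (σ : R →+* R) : Prop where
  prime : p.Prime
  ne_two : p ≠ 2
  lift : IsFrobeniusLift p σ
  injective : Function.Injective σ

/-- The rational function `𝒞_p (A H ^ r) / (f^σ) ^ (m + r)`, where `H = f ^ p - f^σ(x^p)`. -/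
def defectTerm (p : ℕ) (σ : R →+* R) (f A : Laurent R n) (m r : ℕ) : RatFun R n :=
  frac (cartierPoly p (A * frobDefect p σ f ^ r)) (twist σ f) (m + r)

/-- The partial sums of the expansion of `𝒞_p (A / f ^ (p m))`. -/
def cartierSum (p : ℕ) (σ : R →+* R) (f A : Laurent R n) (m N : ℕ) : RatFun R n :=
  ∑ r ∈ Finset.range N, ((-1 : R) ^ r * ((m + r - 1).choose r : R)) • defectTerm p σ f A m r

variable {p : ℕ} {σ : R →+* R} {f : Laurent R n} {μ : Set (Fin n → ℝ)}

theorem sum_cartierTerm (g : Laurent R n) (k N : ℕ) :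
    ∑ r ∈ Finset.range N, cartierTerm p σ f g k r =
      cartierSum p σ f (g * f ^ ((p - 1) * k)) k N := rfl

theorem defectTerm_add (hp : p ≠ 0) (A B : Laurent R n) (m r : ℕ) :
    defectTerm p σ f (A + B) m r = defectTerm p σ f A m r + defectTerm p σ f B m r := by
  rw [defectTerm, add_mul, cartierPoly_add hp, frac_add]; rfl

theorem defectTerm_smul (hp : p ≠ 0) (c : R) (A : Laurent R n) (m r : ℕ) :
    defectTerm p σ f (c • A) m r = c • defectTerm p σ f A m r := by
  rw [defectTerm, smul_mul_assoc, cartierPoly_smul hp, frac_smul]; rfl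

theorem cartierSum_add (hp : p ≠ 0) (A B : Laurent R n) (m N : ℕ) :
    cartierSum p σ f (A + B) m N = cartierSum p σ f A m N + cartierSum p σ f B m N := by
  simp only [cartierSum, defectTerm_add hp, smul_add, Finset.sum_add_distrib]

theorem cartierSum_smul (hp : p ≠ 0) (c : R) (A : Laurent R n) (m N : ℕ) :
    cartierSum p σ f (c • A) m N = c • cartierSum p σ f A m N := by
  simp only [cartierSum, defectTerm_smul hp, Finset.smul_sum, smul_comm c]

/-- `f ^ p = f^σ(x^p) + H`. -/
theorem pow_eq_substPow_add (p : ℕ) (σ : R →+* R) (f : Laurent R n) :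
    f ^ p = substPow p (twist σ f) + frobDefect p σ f := by
  rw [frobDefect]; ring

theorem defectTerm_mul_pow (h : OddFrobenius p σ) (hf : f ≠ 0) (A : Laurent R n) (m r : ℕ) :
    defectTerm p σ f (A * f ^ p) (m + 1) r =
      defectTerm p σ f A m r + defectTerm p σ f A m (r + 1) := by
  have e : A * f ^ p * frobDefect p σ f ^ r =
      A * frobDefect p σ f ^ r * substPow p (twist σ f) + A * frobDefect p σ f ^ (r + 1) := by
    rw [pow_eq_substPow_add]; ring
  have h1 := frac_mul_pow (twist_ne_zero h.injective hf)
    (cartierPoly p (A * frobDefect p σ f ^ r)) (m + r) 1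
  rw [pow_one] at h1
  rw [defectTerm, e, cartierPoly_add h.prime.ne_zero, cartierPoly_mul_substPow h.prime.ne_zero,
    frac_add, show m + 1 + r = m + r + 1 by omega, h1]
  rfl

/-- Replacing `A / f^(pm)` by `(A f^p) / f^(p(m+1))` alters the partial sum by one boundary term
only. -/
theorem cartierSum_mul_pow (h : OddFrobenius p σ) (hf : f ≠ 0) (A : Laurent R n) (m N : ℕ) :
    cartierSum p σ f (A * f ^ p) (m + 1) (N + 1) = cartierSum p σ f A m (N + 1) +
      ((-1 : R) ^ N * ((m + N).choose N : R)) • defectTerm p σ f A m (N + 1) := by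
  simp only [cartierSum, defectTerm_mul_pow h hf]
  exact binomial_telescope _ _ _

/-- The `r`-th power of the defect contributes `p^r`, while a pole of order `m + r` costs `(m + r -
1)!`; the equation for `c` and `d` is the balance of the two. -/
theorem smul_defectTerm_mem (h : OddFrobenius p σ) (hf : Admissible μ f) {A : Laurent R n}
    {m r : ℕ} (hm : 1 ≤ m) (hA : SuppIn A (p * m) μ) {c d : R}
    (hcd : c * (p : R) ^ r = d * ((m + r - 1).factorial : R)) :
    ∃ y : Omega (twist σ f) μ, c • defectTerm p σ f A m r = d • (y : RatFun R n) := by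
  obtain ⟨H, hH, hHs⟩ := exists_eq_smul (p : R) (frobDefect p σ f)
    ((natCast_dvd_iff _ _).1 (dvd_frobDefect h.prime h.lift f))
  have hHs' : SuppIn (H ^ r) (p * r) (newton f) :=
    ((suppIn_frobDefect hf.ne_zero).mono_subset hHs).pow_newton (convex_newton f)
      (newton_nonempty hf.ne_zero) r
  have hpm : 1 ≤ p * m := Nat.mul_pos h.prime.pos hm
  have hB : SuppIn (cartierPoly p (A * H ^ r)) (m + r) μ :=
    (hf.suppIn_mul hpm hA hHs' (Nat.mul_add p m r).symm).cartierPoly h.prime.ne_zero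
  refine ⟨⟨_, factorial_smul_frac_mem (f := twist σ f) (by omega) hB⟩, ?_⟩
  rw [smul_smul, ← hcd, defectTerm, hH, smul_pow, mul_smul_comm, cartierPoly_smul h.prime.ne_zero,
    frac_smul, smul_smul]

/-- The binomial coefficient absorbs most of the cost: its product with `(m-1)! r!` is `(m+r-1)!`,
so only `(m-1)! r!` has to be paid for. -/
theorem smul_choose_defectTerm_mem (h : OddFrobenius p σ) (hf : Admissible μ f) {A : Laurent R n}
    {m r : ℕ} (hm : 1 ≤ m) (hA : SuppIn A (p * m) μ) {c d : R}
    (hcd : c * (p : R) ^ r = d * ((m - 1).factorial * r.factorial : R)) :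
    ∃ y : Omega (twist σ f) μ, c • ((-1 : R) ^ r * ((m + r - 1).choose r : R)) •
      defectTerm p σ f A m r = d • (y : RatFun R n) := by
  have e : ((m + r - 1).choose r * (m - 1).factorial * r.factorial : R) =
      (m + r - 1).factorial := by
    have := Nat.choose_mul_factorial_mul_factorial (show r ≤ m + r - 1 by omega)
    rw [show m + r - 1 - r = m - 1 by omega] at this
    rw [← this]; push_cast; ring
  obtain ⟨y, hy⟩ := smul_defectTerm_mem h hf hm hA (r := r)
    (c := c * ((-1 : R) ^ r * ((m + r - 1).choose r : R))) (d := (-1 : R) ^ r * d) (by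
      rw [← e]
      calc _ = (-1 : R) ^ r * ((m + r - 1).choose r : R) * (c * p ^ r) := by ring
        _ = _ := by rw [hcd]; ring)
  refine ⟨(-1 : R) ^ r • y, ?_⟩
  rw [smul_smul, hy, Submodule.coe_smul, smul_smul, mul_comm]

/-! ### Convergence of rational functions in the completion -/

variable (p μ) in
/-- A sequence of rational functions tending to zero in `Ω_F(μ)`. -/
def NullSeq (F : Laurent R n) (x : ℕ → RatFun R n) : Prop :=
  ∀ s : ℕ, ∃ N₀, ∀ N ≥ N₀, ∃ y : Omega F μ, x N = (p : R) ^ s • (y : RatFun R n)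

/-- A sequence of rational functions, eventually in `Ω_F(μ)`, tending to `η`. -/
def ConvTo {F : Laurent R n} (x : ℕ → RatFun R n) (η : OmegaHat p F μ) : Prop :=
  ∀ s : ℕ, ∃ N₀, ∀ N ≥ N₀, ∃ e : Omega F μ, (e : RatFun R n) = x N ∧
    η - toHat p F μ e ∈ pPow p F μ s

variable {F : Laurent R n} {x x' : ℕ → RatFun R n} {η η' : OmegaHat p F μ}

theorem ConvTo.congr (hx : ConvTo x η) (h : ∀ N, x' N = x N) : ConvTo x' η :=
  (funext h : x' = x) ▸ hx

theorem ConvTo.add (hx : ConvTo x η) (hx' : ConvTo x' η') :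
    ConvTo (fun N => x N + x' N) (η + η') := by
  intro s
  obtain ⟨N₁, h₁⟩ := hx s
  obtain ⟨N₂, h₂⟩ := hx' s
  refine ⟨max N₁ N₂, fun N hN => ?_⟩
  obtain ⟨e, he, hm⟩ := h₁ N (le_of_max_le_left hN)
  obtain ⟨e', he', hm'⟩ := h₂ N (le_of_max_le_right hN)
  refine ⟨e + e', by rw [Submodule.coe_add, he, he'], ?_⟩
  rw [map_add, add_sub_add_comm]
  exact Submodule.add_mem _ hm hm'

theorem ConvTo.smul (hx : ConvTo x η) (c : R) : ConvTo (fun N => c • x N) (c • η) := by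
  intro s
  obtain ⟨N₁, h₁⟩ := hx s
  refine ⟨N₁, fun N hN => ?_⟩
  obtain ⟨e, he, hm⟩ := h₁ N hN
  refine ⟨c • e, by rw [Submodule.coe_smul, he], ?_⟩
  rw [map_smul, ← smul_sub]
  exact Submodule.smul_mem _ _ hm

theorem NullSeq.convTo (hx : NullSeq p μ F x) : ConvTo x (0 : OmegaHat p F μ) := by
  intro s
  obtain ⟨N₁, h₁⟩ := hx s
  refine ⟨N₁, fun N hN => ?_⟩
  obtain ⟨y, hy⟩ := h₁ N hN
  refine ⟨(p : R) ^ s • y, by rw [hy, Submodule.coe_smul], ?_⟩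
  rw [zero_sub, map_smul]
  exact Submodule.neg_mem _ (smul_pow_mem _)

theorem ConvTo.of_null (hx : ConvTo x η) (h : NullSeq p μ F (fun N => x' N - x N)) :
    ConvTo x' η := by
  simpa using hx.add h.convTo

theorem ConvTo.unique (hx : ConvTo x η) (hx' : ConvTo x η') : η = η' := by
  rw [← sub_eq_zero]
  refine eq_zero_of_forall_mem (a := (p : R)) fun s => ?_
  obtain ⟨N₁, h₁⟩ := hx s
  obtain ⟨N₂, h₂⟩ := hx' s
  obtain ⟨e, he, hm⟩ := h₁ _ (le_max_left N₁ N₂)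
  obtain ⟨e', he', hm'⟩ := h₂ _ (le_max_right N₁ N₂)
  obtain rfl : e = e' := Subtype.ext (he.trans he'.symm)
  have := Submodule.sub_mem _ hm hm'
  rwa [sub_sub_sub_cancel_right] at this

theorem NullSeq.add (hx : NullSeq p μ F x) (hx' : NullSeq p μ F x') :
    NullSeq p μ F (fun N => x N + x' N) := by
  intro s
  obtain ⟨N₁, h₁⟩ := hx s
  obtain ⟨N₂, h₂⟩ := hx' s
  refine ⟨max N₁ N₂, fun N hN => ?_⟩
  obtain ⟨e, he⟩ := h₁ N (le_of_max_le_left hN)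
  obtain ⟨e', he'⟩ := h₂ N (le_of_max_le_right hN)
  exact ⟨e + e', by simp only [he, he', Submodule.coe_add, smul_add]⟩

theorem exists_convTo_sum (hx : ∀ r, x r ∈ Omega F μ) (h0 : NullSeq p μ F x) :
    ∃ η : OmegaHat p F μ, ConvTo (fun N => ∑ r ∈ Finset.range N, x r) η := by
  have hm : ∀ N, ∑ r ∈ Finset.range N, x r ∈ Omega F μ :=
    fun N => Submodule.sum_mem _ fun r _ => hx r
  obtain ⟨η, hη⟩ := exists_limit (a := (p : R)) (fun N => (⟨_, hm N⟩ : Omega F μ)) (by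
    intro s
    obtain ⟨N₀, h⟩ := h0 s
    refine ⟨N₀, fun N hN => ?_⟩
    obtain ⟨y, hy⟩ := h N hN
    rw [mem_span_pow_smul_top_iff]
    refine ⟨y, Subtype.ext ?_⟩
    change ∑ r ∈ Finset.range (N + 1), x r - ∑ r ∈ Finset.range N, x r = _
    rw [Finset.sum_range_succ, add_sub_cancel_left, hy, Submodule.coe_smul])
  refine ⟨η, fun s => ?_⟩
  obtain ⟨N₀, h⟩ := hη s
  exact ⟨N₀, fun N hN => ⟨⟨_, hm N⟩, rfl, h N hN⟩⟩

end CartierSums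

/-! ### Existence and uniqueness of the Cartier operator -/

section CartierOperator

set_option linter.unusedSectionVars false

theorem add_pred_mul {p : ℕ} (hp : 0 < p) (k : ℕ) : k + (p - 1) * k = p * k := by
  obtain ⟨q, rfl⟩ := Nat.exists_eq_add_of_le' (Nat.succ_le_of_lt hp)
  rw [Nat.succ_eq_add_one, Nat.add_sub_cancel]
  ring

variable {R : Type*} [CommRing R] [IsDomain R] {n : ℕ} {p : ℕ}
  {σ : R →+* R} {f : Laurent R n} {μ : Set (Fin n → ℝ)}

theorem isCartier_unique {C C' : OmegaHat p f μ →ₗ[R] OmegaHat p (twist σ f) μ}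
    (hC : IsCartier p σ f μ C) (hC' : IsCartier p σ f μ C') : C = C' := by
  refine hat_hom_ext fun ⟨ω, hω⟩ => ?_
  change C (toHat p f μ _) = C' (toHat p f μ _)
  induction hω using Submodule.span_induction with
  | mem x hx =>
    obtain ⟨k, g, hk, hg, rfl⟩ := hx
    exact ConvTo.unique (hC k g hk hg ⟨_, factorial_smul_frac_mem hk hg⟩ rfl)
      (hC' k g hk hg ⟨_, factorial_smul_frac_mem hk hg⟩ rfl)
  | zero =>
    change C (toHat p f μ 0) = C' (toHat p f μ 0)
    simp only [map_zero]
  | add x y hx hy ihx ihy =>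
    change C (toHat p f μ (⟨x, hx⟩ + ⟨y, hy⟩)) = C' (toHat p f μ (⟨x, hx⟩ + ⟨y, hy⟩))
    rw [map_add, map_add, map_add, ihx, ihy]
  | smul r x hx ih =>
    change C (toHat p f μ (r • ⟨x, hx⟩)) = C' (toHat p f μ (r • ⟨x, hx⟩))
    rw [map_smul, map_smul, map_smul, ih]

variable [CharZero R] [IsAdicComplete (Ideal.span {(p : R)}) R]

/-- The boundary term has size `p^(N+1) / (m! N!)`, where `m` is fixed. -/
theorem nullSeq_cartierSum_mul_pow (h : OddFrobenius p σ) (hf : Admissible μ f)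
    {A : Laurent R n} {m : ℕ} (hm : 1 ≤ m) (hA : SuppIn A (p * m) μ) :
    NullSeq p μ (twist σ f)
      (fun N => cartierSum p σ f (A * f ^ p) (m + 1) N - cartierSum p σ f A m N) := by
  intro s
  obtain ⟨N₀, hN₀⟩ := exists_pow_mul_factorial_dvd (R := R) h.prime h.ne_two m.factorial_ne_zero s
  refine ⟨N₀ + 1, fun N hN => ?_⟩
  obtain ⟨N, rfl⟩ := Nat.exists_eq_add_of_le' (show 1 ≤ N by omega)
  obtain ⟨e, he⟩ := (hN₀ N (by omega)).trans (pow_dvd_pow _ N.le_succ)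
  have hch : ((m + N).choose N * m.factorial * N.factorial : R) = (m + N).factorial := by
    have := Nat.choose_mul_factorial_mul_factorial (Nat.le_add_left N m)
    rw [Nat.add_sub_cancel] at this
    rw [← this]; push_cast; ring
  obtain ⟨y, hy⟩ := smul_defectTerm_mem h hf hm hA (r := N + 1)
    (c := (-1 : R) ^ N * ((m + N).choose N : R)) (d := (p : R) ^ s * ((-1) ^ N * e)) (by
      rw [he, show m + (N + 1) - 1 = m + N by omega, ← hch]; push_cast; ring)
  refine ⟨((-1) ^ N * e) • y, ?_⟩
  beta_reduce
  rw [cartierSum_mul_pow h hf.ne_zero, add_sub_cancel_left, hy, mul_smul, Submodule.coe_smul]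

theorem nullSeq_cartierSum_mul_pow_mul (h : OddFrobenius p σ) (hf : Admissible μ f)
    {A : Laurent R n} {m : ℕ} (hm : 1 ≤ m) (hA : SuppIn A (p * m) μ) (j : ℕ) :
    NullSeq p μ (twist σ f)
      (fun N => cartierSum p σ f (A * f ^ (p * j)) (m + j) N - cartierSum p σ f A m N) := by
  induction j with
  | zero => exact fun s => ⟨0, fun N _ => ⟨0, by simp⟩⟩
  | succ j ih =>
    have hA' : SuppIn (A * f ^ (p * j)) (p * (m + j)) μ :=
      hf.suppIn_mul_pow (Nat.mul_pos h.prime.pos hm) hA (by ring)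
    have := (nullSeq_cartierSum_mul_pow h hf (by omega) hA').add ih
    simpa only [sub_add_sub_cancel, mul_assoc, ← pow_add, ← Nat.mul_succ, ← add_assoc] using this

/-- Both expansions are compared with the one over the common denominator `f^(p(m+l))`. Hence the
limit depends on the rational function and not on the chosen fraction. -/
theorem nullSeq_cartierSum_sub (h : OddFrobenius p σ) (hf : Admissible μ f)
    {A B : Laurent R n} {m l : ℕ} (hm : 1 ≤ m) (hA : SuppIn A (p * m) μ) (hl : 1 ≤ l)
    (hB : SuppIn B (p * l) μ) (hAB : frac A f (p * m) = frac B f (p * l)) :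
    NullSeq p μ (twist σ f) (fun N => cartierSum p σ f A m N - cartierSum p σ f B l N) := by
  have h1 := nullSeq_cartierSum_mul_pow_mul h hf hm hA l
  have h2 := nullSeq_cartierSum_mul_pow_mul h hf hl hB m
  rw [(frac_eq_iff hf.ne_zero).1 hAB, add_comm m l] at h1
  intro s
  obtain ⟨N₁, h₁⟩ := h1 s
  obtain ⟨N₂, h₂⟩ := h2 s
  refine ⟨max N₁ N₂, fun N hN => ?_⟩
  obtain ⟨e, he⟩ := h₁ N (le_of_max_le_left hN)
  obtain ⟨e', he'⟩ := h₂ N (le_of_max_le_right hN)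
  refine ⟨e' - e, ?_⟩
  rw [Submodule.coe_sub, smul_sub, ← he, ← he', sub_sub_sub_cancel_left]

/-- The expansion of the image of a generator `(k-1)! g / f ^ k`. -/
theorem exists_convTo_generator (h : OddFrobenius p σ) (hf : Admissible μ f) {k : ℕ}
    {A : Laurent R n} (hk : 1 ≤ k) (hA : SuppIn A (p * k) μ) :
    ∃ η : OmegaHat p (twist σ f) μ,
      ConvTo (cartierSum p σ f (((k - 1).factorial : R) • A) k) η := by
  have hs : SuppIn (((k - 1).factorial : R) • A) (p * k) μ := hA.smul _
  have key : ∀ (r : ℕ) (d : R), (p : R) ^ r = d * r.factorial →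
      ∃ y : Omega (twist σ f) μ, ((-1 : R) ^ r * ((k + r - 1).choose r : R)) •
        defectTerm p σ f (((k - 1).factorial : R) • A) k r = d • (y : RatFun R n) := by
    intro r d hd
    -- The `(k-1)!` of the generator pays for its pole order, so only `r!` is left against `p^r`.
    obtain ⟨y, hy⟩ := smul_choose_defectTerm_mem h hf hk hA (r := r)
      (c := ((k - 1).factorial : R)) (d := d) (by rw [hd]; ring)
    exact ⟨y, by rw [defectTerm_smul h.prime.ne_zero, smul_comm, hy]⟩
  refine exists_convTo_sum (fun r => ?_) fun s => ?_
  · obtain ⟨d, hd⟩ := factorial_dvd_pow (R := R) h.prime h.ne_two r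
    obtain ⟨y, hy⟩ := key r d (by rw [hd, mul_comm])
    rw [hy]
    exact Submodule.smul_mem _ _ y.2
  · obtain ⟨N₀, hN₀⟩ := exists_pow_mul_factorial_dvd (R := R) h.prime h.ne_two one_ne_zero s
    refine ⟨N₀, fun r hr => ?_⟩
    obtain ⟨e, he⟩ := hN₀ r hr
    obtain ⟨y, hy⟩ := key r ((p : R) ^ s * e) (by rw [he]; push_cast; ring)
    exact ⟨e • y, by rw [hy, mul_smul, Submodule.coe_smul]⟩

/-- A sum of generators over a common denominator no longer shows its factorials, so convergence is
carried through the span by adding sequences that already converge. -/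
theorem exists_convTo (h : OddFrobenius p σ) (hf : Admissible μ f) {ω : RatFun R n}
    (hω : ω ∈ Omega f μ) :
    ∃ (m : ℕ) (A : Laurent R n) (η : OmegaHat p (twist σ f) μ), 1 ≤ m ∧ SuppIn A (p * m) μ ∧
      ω = frac A f (p * m) ∧ ConvTo (cartierSum p σ f A m) η := by
  have hp := h.prime.ne_zero
  induction hω using Submodule.span_induction with
  | mem x hx =>
    obtain ⟨k, g, hk, hg, rfl⟩ := hx
    have hpk := add_pred_mul h.prime.pos k
    have hA : SuppIn (g * f ^ ((p - 1) * k)) (p * k) μ := hf.suppIn_mul_pow hk hg hpk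
    obtain ⟨η, hη⟩ := exists_convTo_generator h hf hk hA
    refine ⟨k, _, η, hk, hA.smul _, ?_, hη⟩
    rw [frac_smul, ← hpk, frac_mul_pow hf.ne_zero]
  | zero =>
    refine ⟨1, 0, 0, le_rfl, suppIn_zero _ _, (frac_zero _ _).symm, ?_⟩
    refine NullSeq.convTo fun s => ⟨0, fun N _ => ⟨0, ?_⟩⟩
    have h0 := cartierSum_smul (σ := σ) (f := f) hp 0 0 1 N
    simpa using h0
  | add x y _ _ hx hy =>
    obtain ⟨m, A, η, hm, hA, rfl, hη⟩ := hx
    obtain ⟨l, B, θ, hl, hB, rfl, hθ⟩ := hy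
    have hA' : SuppIn (A * f ^ (p * l)) (p * (m + l)) μ :=
      hf.suppIn_mul_pow (Nat.mul_pos h.prime.pos hm) hA (by ring)
    have hB' : SuppIn (B * f ^ (p * m)) (p * (m + l)) μ :=
      hf.suppIn_mul_pow (Nat.mul_pos h.prime.pos hl) hB (by ring)
    have h1 := hη.of_null (nullSeq_cartierSum_mul_pow_mul h hf hm hA l)
    have h2 := hθ.of_null (nullSeq_cartierSum_mul_pow_mul h hf hl hB m)
    rw [add_comm l m] at h2
    refine ⟨m + l, A * f ^ (p * l) + B * f ^ (p * m), η + θ, by omega, hA'.add hB', ?_, ?_⟩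
    · rw [frac_add, mul_add, frac_mul_pow hf.ne_zero, add_comm (p * m), frac_mul_pow hf.ne_zero]
    · exact (h1.add h2).congr fun N => cartierSum_add hp _ _ _ N
  | smul r x _ hx =>
    obtain ⟨m, A, η, hm, hA, rfl, hη⟩ := hx
    exact ⟨m, r • A, r • η, hm, hA.smul r, (frac_smul _ _ _ _).symm,
      (hη.smul r).congr fun N => cartierSum_smul hp r A m N⟩

/-- One fraction per form is chosen to define the limit; independence of the fraction then gives
convergence for every other one, and linearity follows from uniqueness of limits. -/
theorem exists_cartierMap (h : OddFrobenius p σ) (hf : Admissible μ f) :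
    ∃ C : OmegaHat p f μ →ₗ[R] OmegaHat p (twist σ f) μ,
      ∀ (ω : Omega f μ) (m : ℕ) (A : Laurent R n), 1 ≤ m → SuppIn A (p * m) μ →
        (ω : RatFun R n) = frac A f (p * m) →
        ConvTo (cartierSum p σ f A m) (C (toHat p f μ ω)) := by
  have hp := h.prime.ne_zero
  choose m A η hm hA hω hη using fun ω : Omega f μ => exists_convTo h hf ω.2
  have key : ∀ (ω : Omega f μ) (l : ℕ) (B : Laurent R n), 1 ≤ l → SuppIn B (p * l) μ →
      (ω : RatFun R n) = frac B f (p * l) → ConvTo (cartierSum p σ f B l) (η ω) :=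
    fun ω l B hl hB he => (hη ω).of_null
      (nullSeq_cartierSum_sub h hf hl hB (hm ω) (hA ω) (he ▸ hω ω))
  let L : Omega f μ →ₗ[R] OmegaHat p (twist σ f) μ :=
    { toFun := η
      map_add' := by
        intro ω θ
        have hA' : SuppIn (A ω * f ^ (p * m θ)) (p * (m ω + m θ)) μ :=
          hf.suppIn_mul_pow (Nat.mul_pos h.prime.pos (hm ω)) (hA ω) (by ring)
        have hB' : SuppIn (A θ * f ^ (p * m ω)) (p * (m ω + m θ)) μ :=
          hf.suppIn_mul_pow (Nat.mul_pos h.prime.pos (hm θ)) (hA θ) (by ring)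
        have hle : 1 ≤ m ω + m θ := by have := hm ω; omega
        have e1 : (ω : RatFun R n) = frac (A ω * f ^ (p * m θ)) f (p * (m ω + m θ)) := by
          rw [mul_add, frac_mul_pow hf.ne_zero, ← hω]
        have e2 : (θ : RatFun R n) = frac (A θ * f ^ (p * m ω)) f (p * (m ω + m θ)) := by
          rw [mul_add, add_comm (p * m ω), frac_mul_pow hf.ne_zero, ← hω]
        have h1 := (key ω _ _ hle hA' e1).add (key θ _ _ hle hB' e2)
        simp only [← cartierSum_add hp] at h1
        exact ConvTo.unique (key (ω + θ) _ _ hle (hA'.add hB')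
          (by rw [Submodule.coe_add, frac_add, ← e1, ← e2])) h1
      map_smul' := by
        intro c ω
        have h1 := (hη ω).smul c
        simp only [← cartierSum_smul hp] at h1
        exact ConvTo.unique (key (c • ω) _ _ (hm ω) ((hA ω).smul c)
          (by rw [Submodule.coe_smul, frac_smul, ← hω])) h1 }
  obtain ⟨C, hC⟩ := exists_hat_lift L
  refine ⟨C, fun ω l B hl hB he => ?_⟩
  have e : C (toHat p f μ ω) = η ω := hC ω
  rw [e]
  exact key ω l B hl hB he

theorem isCartier_of_convTo (h : OddFrobenius p σ) (hf : Admissible μ f)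
    {C : OmegaHat p f μ →ₗ[R] OmegaHat p (twist σ f) μ}
    (hC : ∀ (ω : Omega f μ) (m : ℕ) (A : Laurent R n), 1 ≤ m → SuppIn A (p * m) μ →
        (ω : RatFun R n) = frac A f (p * m) →
        ConvTo (cartierSum p σ f A m) (C (toHat p f μ ω))) : IsCartier p σ f μ C := by
  intro k g hk hg ω hω
  have hpk := add_pred_mul h.prime.pos k
  have hA : SuppIn (g * f ^ ((p - 1) * k)) (p * k) μ := hf.suppIn_mul_pow hk hg hpk
  have := hC ω k (((k - 1).factorial : R) • (g * f ^ ((p - 1) * k))) hk (hA.smul _) (by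
    rw [hω, frac_smul, ← hpk, frac_mul_pow hf.ne_zero])
  simp only [sum_cartierTerm, ← cartierSum_smul h.prime.ne_zero]
  exact this

theorem existsUnique_isCartier (h : OddFrobenius p σ) (hf : Admissible μ f) :
    ∃! C, IsCartier p σ f μ C := by
  obtain ⟨C, hC⟩ := exists_cartierMap h hf
  have hC' := isCartier_of_convTo h hf hC
  exact ⟨C, hC', fun C₁ h₁ => isCartier_unique h₁ hC'⟩

theorem isCartier_cartier (h : OddFrobenius p σ) (hf : Admissible μ f) :
    IsCartier p σ f μ (cartier p σ f μ) := by
  have hex := (existsUnique_isCartier h hf).exists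
  rw [cartier, dif_pos hex]
  exact hex.choose_spec

theorem convTo_cartier (h : OddFrobenius p σ) (hf : Admissible μ f) (ω : Omega f μ) {m : ℕ}
    {A : Laurent R n} (hm : 1 ≤ m) (hA : SuppIn A (p * m) μ)
    (hω : (ω : RatFun R n) = frac A f (p * m)) :
    ConvTo (cartierSum p σ f A m) (cartier p σ f μ (toHat p f μ ω)) := by
  obtain ⟨C, hC⟩ := exists_cartierMap (σ := σ) h hf
  rw [isCartier_unique (isCartier_cartier h hf) (isCartier_of_convTo h hf hC)]
  exact hC ω m A hm hA hω

end CartierOperator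

/-! ### The Hasse–Witt map -/

section HasseWitt

set_option linter.unusedSectionVars false

variable {R : Type*} [CommRing R] [IsDomain R] {n : ℕ} {p : ℕ} {σ : R →+* R} {f : Laurent R n}
  {μ : Set (Fin n → ℝ)}

variable (R) in
/-- The Laurent polynomials with support in `μ`, the numerators of the forms with a simple pole. -/
def numerators (μ : Set (Fin n → ℝ)) : Submodule R (Laurent R n) where
  carrier := {g | SuppIn g 1 μ}
  add_mem' := SuppIn.add
  zero_mem' := suppIn_zero 1 μ
  smul_mem' c _ hg := hg.smul c

/-- The Hasse–Witt matrix with respect to a finite set of lattice points. -/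
def hasseWittOn (p : ℕ) (f : Laurent R n) (L : Finset (Fin n → ℤ)) : Matrix L L R :=
  fun u v => (f ^ (p - 1)).coeff (p • v.1 - u.1)

theorem isUnit_hasseWitt_twist (hσ : Function.Injective σ) (hf : IsUnit (hasseWitt p f μ)) :
    IsUnit (hasseWitt p (twist σ f) μ) := by
  change IsUnit (hasseWittOn p (twist σ f) (latticePts (twist σ f) μ))
  -- The matrices for `f` and `f^σ` are indexed by different expressions for the same finite set;
  -- the variant over an arbitrary set `L` makes the rewriting possible.
  rw [latticePts_twist hσ]
  have e : hasseWittOn p (twist σ f) (latticePts f μ) = σ.mapMatrix (hasseWitt p f μ) := by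
    ext u v
    rw [RingHom.mapMatrix_apply, Matrix.map_apply, hasseWitt, ← coeff_twist]
    simp only [hasseWittOn, twist, map_pow]
  rw [e]
  exact hf.map _

variable {L : Finset (Fin n → ℤ)}

/-- The Laurent polynomial with given coefficients on a finite set of exponents. -/
def ofCoeffs (L : Finset (Fin n → ℤ)) (c : L → R) : Laurent R n := ∑ w : L, mono w.1 (c w)

theorem coeff_ofCoeffs (c : L → R) (w : L) : (ofCoeffs L c).coeff w.1 = c w := by
  rw [ofCoeffs, AddMonoidAlgebra.coeff_sum, Finsupp.finsetSum_apply]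
  simp only [coeff_mono]
  rw [Finset.sum_eq_single w]
  · simp
  · intro b _ hb
    rw [if_neg fun h => hb (Subtype.ext h)]
  · simp

theorem ofCoeffs_mem (hL : ∀ w ∈ L, toReal w ∈ μ) (c : L → R) : ofCoeffs L c ∈ numerators R μ := by
  refine Submodule.sum_mem _ fun w _ => ?_
  exact suppIn_mono _ (by simpa using hL _ w.2)

theorem coeff_eq_zero_of_mem (hL : ∀ w, toReal w ∈ μ → w ∈ L) {g : Laurent R n}
    (hg : g ∈ numerators R μ) {u : Fin n → ℤ} (hu : u ∉ L) : g.coeff u = 0 := by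
  by_contra h
  have := suppIn_iff.1 hg u h
  rw [Nat.cast_one, one_smul] at this
  exact hu (hL u this)

theorem numerators_ext (hL : ∀ w, toReal w ∈ μ → w ∈ L) {g h : Laurent R n}
    (hg : g ∈ numerators R μ) (hh : h ∈ numerators R μ)
    (hgh : ∀ w : L, g.coeff w.1 = h.coeff w.1) : g = h := by
  ext u
  by_cases hu : u ∈ L
  · exact hgh ⟨u, hu⟩
  · rw [coeff_eq_zero_of_mem hL hg hu, coeff_eq_zero_of_mem hL hh hu]

theorem ofCoeffs_coeff (hL : ∀ w, toReal w ∈ μ ↔ w ∈ L) {g : Laurent R n}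
    (hg : g ∈ numerators R μ) : ofCoeffs L (fun w => g.coeff w.1) = g :=
  numerators_ext (fun w => (hL w).1) (ofCoeffs_mem (fun w => (hL w).2) _) hg
    fun w => coeff_ofCoeffs _ w

/-- The origin of the Hasse–Witt matrix: the coefficient of `x^(pw)` in the product is a convolution
over the lattice points of `μ`. -/
theorem coeff_cartierPoly_mul (hp : p ≠ 0) (hL : ∀ w, toReal w ∈ μ → w ∈ L) {g : Laurent R n}
    (hg : g ∈ numerators R μ) (w : L) :
    (cartierPoly p (g * f ^ (p - 1))).coeff w.1 =
      Matrix.vecMul (fun u : L => g.coeff u.1) (hasseWittOn p f L) w := by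
  rw [coeff_cartierPoly hp, AddMonoidAlgebra.coeff_mul_apply_left, Finsupp.sum]
  simp only [neg_add_eq_sub]
  refine Eq.trans ?_ (Finset.sum_coe_sort L
    (fun u => g.coeff u * (f ^ (p - 1)).coeff (p • w.1 - u))).symm
  refine Finset.sum_subset (fun u hu => ?_) fun u _ hu => ?_
  · by_contra h
    exact Finsupp.mem_support_iff.1 hu (coeff_eq_zero_of_mem hL hg h)
  · rw [Finsupp.notMem_support_iff.1 hu, zero_mul]

/-- `f` and `μ` satisfy the hypotheses of the main theorem: the Hasse–Witt matrix is invertible. -/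
structure Ordinary (p : ℕ) (μ : Set (Fin n → ℝ)) (f : Laurent R n) : Prop
    extends Admissible μ f where
  isUnit : IsUnit (hasseWitt p f μ)

theorem Admissible.cartierPoly_mem (hf : Admissible μ f) (hp : 0 < p) {g : Laurent R n}
    (hg : g ∈ numerators R μ) : cartierPoly p (g * f ^ (p - 1)) ∈ numerators R μ :=
  SuppIn.cartierPoly hp.ne'
    (hf.suppIn_mul_pow le_rfl hg (by rw [Nat.add_sub_cancel' hp, mul_one]))

theorem Ordinary.dvd_of_dvd (hf : Ordinary p μ f) (hp : p ≠ 0) {g : Laurent R n}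
    (hg : g ∈ numerators R μ) (h : (p : Laurent R n) ∣ cartierPoly p (g * f ^ (p - 1))) :
    (p : Laurent R n) ∣ g := by
  have hL := fun w => (mem_latticePts hf.isOpen w).2
  rw [natCast_dvd_iff] at *
  intro u
  by_cases hu : u ∈ latticePts f μ
  · obtain ⟨B, hB⟩ := hf.isUnit.exists_right_inv
    have h1 : Matrix.vecMul (Matrix.vecMul (fun u : latticePts f μ => g.coeff u.1)
        (hasseWitt p f μ)) B = fun u : latticePts f μ => g.coeff u.1 := by
      rw [Matrix.vecMul_vecMul, hB, Matrix.vecMul_one]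
    have h2 := congrFun h1 ⟨u, hu⟩
    rw [← h2]
    refine Finset.dvd_sum fun w _ => Dvd.dvd.mul_right ?_ _
    have h3 := h w.1
    rwa [coeff_cartierPoly_mul hp hL hg] at h3
  · rw [coeff_eq_zero_of_mem hL hg hu]
    exact dvd_zero _

theorem Ordinary.exists_cartierPoly_eq (hf : Ordinary p μ f) (hp : 0 < p) {h : Laurent R n}
    (hh : h ∈ numerators R μ) :
    ∃ g ∈ numerators R μ, cartierPoly p (g * f ^ (p - 1)) = h := by
  have hL := fun w => (mem_latticePts hf.isOpen w).2
  obtain ⟨B, hB⟩ := hf.isUnit.exists_left_inv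
  let c := Matrix.vecMul (fun u : latticePts f μ => h.coeff u.1) B
  have hg : ofCoeffs _ c ∈ numerators R μ :=
    ofCoeffs_mem (fun w => (mem_latticePts hf.isOpen w).1) c
  refine ⟨_, hg, numerators_ext hL (hf.cartierPoly_mem hp hg) hh fun w => ?_⟩
  rw [coeff_cartierPoly_mul hp.ne' hL hg]
  simp only [coeff_ofCoeffs, c]
  change Matrix.vecMul (Matrix.vecMul _ B) (hasseWitt p f μ) w = _
  rw [Matrix.vecMul_vecMul, hB, Matrix.vecMul_one]

theorem Ordinary.twisted (hf : Ordinary p μ f) (hσ : Function.Injective σ) :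
    Ordinary p μ (twist σ f) :=
  ⟨hf.toAdmissible.twisted hσ, isUnit_hasseWitt_twist hσ hf.isUnit⟩

end HasseWitt

/-! ### Cancelling powers of `f` modulo `p` -/

section OrdinaryDvd

variable {R : Type*} [CommRing R] [IsDomain R] {n : ℕ} {p : ℕ} {σ : R →+* R}
  {μ : Set (Fin n → ℝ)}

/-- `R / p` is not assumed to be a domain, so `f` might be a zero divisor modulo `p`; invertibility
of the Hasse–Witt matrix replaces cancellation. Since `f^p ≡ f^σ(x^p)` modulo `p`, applying `𝒞_p`
leaves the same statement for `f^σ` with `M` lowered by one. -/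
theorem Ordinary.dvd_of_dvd_mul_pow (h : OddFrobenius p σ) (M : ℕ) {f : Laurent R n}
    (hf : Ordinary p μ f) {g : Laurent R n} (hg : g ∈ numerators R μ)
    (hd : (p : Laurent R n) ∣ g * f ^ (p ^ M - 1)) : (p : Laurent R n) ∣ g := by
  have hp := h.prime.ne_zero
  induction M generalizing f g with
  | zero => simpa using hd
  | succ M ih =>
    have hM : 0 < p ^ M := Nat.pow_pos h.prime.pos
    -- The part `p - 1` feeds the Hasse–Witt operator; the rest is a power of `f^p`, which passes
    -- through `𝒞_p`.
    have he : p ^ (M + 1) - 1 = (p - 1) + p * (p ^ M - 1) := by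
      obtain ⟨q, hq⟩ := Nat.exists_eq_add_of_le' (Nat.succ_le_of_lt hM)
      have := h.prime.pos
      rw [pow_succ', hq, Nat.succ_eq_add_one, zero_add, Nat.add_sub_cancel, Nat.mul_succ]
      omega
    rw [he, pow_add, pow_mul, ← mul_assoc] at hd
    have h1 : (p : Laurent R n) ∣ (f ^ p) ^ (p ^ M - 1) - substPow p (twist σ f) ^ (p ^ M - 1) :=
      (dvd_frobDefect h.prime h.lift f).trans (sub_dvd_pow_sub_pow _ _ _)
    have h2 : (p : Laurent R n) ∣ g * f ^ (p - 1) * substPow p (twist σ f ^ (p ^ M - 1)) := by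
      have := dvd_sub hd (h1.mul_left (g * f ^ (p - 1)))
      rw [← mul_sub, sub_sub_cancel] at this
      rwa [substPow_eq, map_pow, ← substPow_eq]
    refine hf.dvd_of_dvd hp hg (ih (hf.twisted h.injective) (hf.cartierPoly_mem h.prime.pos hg) ?_)
    rw [← cartierPoly_mul_substPow hp, natCast_dvd_iff]
    intro u
    rw [coeff_cartierPoly hp]
    exact (natCast_dvd_iff _ _).1 h2 _

end OrdinaryDvd

/-! ### The Cartier operator modulo `p` -/

section Decomposition

set_option linter.unusedSectionVars false

variable {R : Type*} [CommRing R] [IsDomain R] {n : ℕ} {p : ℕ}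
  {σ : R →+* R} {f : Laurent R n} {μ : Set (Fin n → ℝ)}

/-- The form `g / f` in the completion of `Ω_f(μ)`. -/
def simplePole (p : ℕ) (f : Laurent R n) (μ : Set (Fin n → ℝ)) :
    numerators R μ →ₗ[R] OmegaHat p f μ :=
  toHat p f μ ∘ₗ
    { toFun := fun g => ⟨frac g.1 f 1, frac_one_mem g.2⟩
      map_add' := fun g h => Subtype.ext (frac_add g.1 h.1 f 1)
      map_smul' := fun c g => Subtype.ext (frac_smul c g.1 f 1) }

theorem simplePole_apply (g : numerators R μ) :
    simplePole p f μ g = toHat p f μ ⟨frac g.1 f 1, frac_one_mem g.2⟩ := rfl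

variable [CharZero R]

theorem hat_smul_eq_zero (hp : p ≠ 0) (x : OmegaHat p f μ) (hx : (p : R) • x = 0) : x = 0 :=
  hat_torsionFree (omega_torsionFree hp) x hx

theorem exists_eq_smul_of_dvd {s : ℕ} {g : Laurent R n} (hg : g ∈ numerators R μ)
    (h : ∀ u, (p : R) ^ s ∣ g.coeff u) :
    ∃ g' : numerators R μ, (⟨g, hg⟩ : numerators R μ) = (p : R) ^ s • g' := by
  obtain ⟨g', he, hs⟩ := exists_eq_smul _ g h
  exact ⟨⟨g', SuppIn.mono_subset hg hs⟩, Subtype.ext he⟩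

variable [IsAdicComplete (Ideal.span {(p : R)}) R]

/-- If all terms but the leading one of the expansion of `𝒞_p` are divisible by `p`, then `𝒞_p` is
given modulo `p` by the leading term. -/
theorem cartier_sub_simplePole_mem (h : OddFrobenius p σ) (hf : Admissible μ f) {ω : Omega f μ}
    {m : ℕ} (hm : 1 ≤ m) {A : Laurent R n} (hA : SuppIn A (p * m) μ) {c : R}
    (hω : (ω : RatFun R n) = frac (c • A) f (p * m))
    (hc : ∀ r, 1 ≤ r → ∃ d, c * (p : R) ^ r = p * d * ((m - 1).factorial * r.factorial : R))
    (g : numerators R μ)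
    (hg : ∃ y : Omega (twist σ f) μ, defectTerm p σ f (c • A) m 0 =
      frac g.1 (twist σ f) 1 + (p : R) • (y : RatFun R n)) :
    cartier p σ f μ (toHat p f μ ω) - simplePole p (twist σ f) μ g ∈
      pPow p (twist σ f) μ 1 := by
  have hN : ∀ N, ∃ y : Omega (twist σ f) μ, cartierSum p σ f (c • A) m (N + 1) =
      frac g.1 (twist σ f) 1 + (p : R) • (y : RatFun R n) := by
    intro N
    induction N with
    | zero => simpa [cartierSum] using hg
    | succ N ih =>
      obtain ⟨y, hy⟩ := ih
      obtain ⟨d, hd⟩ := hc (N + 1) (by omega)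
      obtain ⟨z, hz⟩ := smul_choose_defectTerm_mem h hf hm hA hd
      refine ⟨y + d • z, ?_⟩
      rw [cartierSum, Finset.sum_range_succ, ← cartierSum, hy, defectTerm_smul h.prime.ne_zero,
        smul_comm, hz, Submodule.coe_add, Submodule.coe_smul, smul_add, mul_smul, add_assoc]
  obtain ⟨N₀, hN₀⟩ := convTo_cartier h hf ω hm (hA.smul c) hω 1
  obtain ⟨e, he, hmem⟩ := hN₀ (N₀ + 1) (Nat.le_succ _)
  obtain ⟨y, hy⟩ := hN N₀
  have e1 : e = ⟨frac g.1 (twist σ f) 1, frac_one_mem g.2⟩ + (p : R) ^ 1 • y :=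
    Subtype.ext (by rw [he, hy, Submodule.coe_add, Submodule.coe_smul, pow_one])
  have e2 : toHat p (twist σ f) μ e - simplePole p (twist σ f) μ g ∈ pPow p (twist σ f) μ 1 := by
    rw [e1, map_add, simplePole_apply, add_sub_cancel_left, map_smul]
    exact smul_pow_mem _
  have := Submodule.add_mem _ hmem e2
  rwa [sub_add_sub_cancel] at this

/-- The image of `g / f` under the Hasse–Witt operator. -/
theorem cartier_simplePole (h : OddFrobenius p σ) (hf : Admissible μ f) (g : numerators R μ) :
    cartier p σ f μ (simplePole p f μ g) - simplePole p (twist σ f) μ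
      ⟨cartierPoly p (g.1 * f ^ (p - 1)), hf.cartierPoly_mem h.prime.pos g.2⟩ ∈
      pPow p (twist σ f) μ 1 := by
  have hp1 : 1 + (p - 1) = p * 1 := by rw [Nat.add_sub_cancel' h.prime.pos, mul_one]
  refine cartier_sub_simplePole_mem h hf le_rfl (A := g.1 * f ^ (p - 1)) (c := 1)
    (hf.suppIn_mul_pow le_rfl g.2 hp1) ?_ ?_ _ ⟨0, ?_⟩
  · rw [one_smul, ← hp1, frac_mul_pow hf.ne_zero]
    rfl
  · intro r hr
    obtain ⟨d, hd⟩ := prime_mul_factorial_dvd_pow (R := R) h.prime h.ne_two hr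
    exact ⟨d, by rw [hd]; simp; ring⟩
  · simp [defectTerm]

/-- The image of `𝒞_p` is spanned modulo `p` by forms with a simple pole. -/
theorem exists_cartier_sub_simplePole_mem (h : OddFrobenius p σ) (hf : Admissible μ f)
    (x : OmegaHat p f μ) : ∃ g : numerators R μ,
      cartier p σ f μ x - simplePole p (twist σ f) μ g ∈ pPow p (twist σ f) μ 1 := by
  have hsub : ∀ ω : Omega f μ, cartier p σ f μ (toHat p f μ ω) ∈
      LinearMap.range (simplePole p (twist σ f) μ) ⊔ pPow p (twist σ f) μ 1 := by
    rintro ⟨ω, hω⟩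
    induction hω using Submodule.span_induction with
    | mem x hx =>
      obtain ⟨k, g, hk, hg, rfl⟩ := hx
      have hp := h.prime.pos
      -- The pole order is rounded up to the next multiple `p(j+1)` of `p`. Then `(k-1)!` is
      -- divisible by `p^j j!`, whereas a pole of order `j + 1` costs only `j!`. For `j = 0` the
      -- leading term has a simple pole; for `j > 0` it is divisible by `p`.
      obtain ⟨j, i, hj, hi⟩ : ∃ j i, p * j ≤ k - 1 ∧ k + i = p * (j + 1) := by
        refine ⟨(k - 1) / p, p * ((k - 1) / p + 1) - k, Nat.mul_div_le _ _, ?_⟩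
        have h1 := Nat.div_add_mod (k - 1) p
        have h2 := Nat.mod_lt (k - 1) hp
        rw [Nat.mul_succ]
        omega
      have hA : SuppIn (g * f ^ i) (p * (j + 1)) μ := hf.suppIn_mul_pow hk hg hi
      obtain ⟨e, he⟩ := (pow_mul_factorial_dvd hp j).trans (Nat.factorial_dvd_factorial hj)
      have hc : ((k - 1).factorial : R) = (p : R) ^ j * j.factorial * e := by
        rw [he]; push_cast; ring
      obtain ⟨g', hg'⟩ : ∃ g' : numerators R μ, ∃ y : Omega (twist σ f) μ,
          defectTerm p σ f (((k - 1).factorial : R) • (g * f ^ i)) (j + 1) 0 =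
            frac g'.1 (twist σ f) 1 + (p : R) • (y : RatFun R n) := by
        rcases Nat.eq_zero_or_pos j with rfl | hj0
        · refine ⟨⟨cartierPoly p (((k - 1).factorial : R) • (g * f ^ i)),
            (hA.smul _).cartierPoly hp.ne'⟩, 0, ?_⟩
          simp [defectTerm]
        · obtain ⟨q, rfl⟩ := Nat.exists_eq_add_of_le' hj0
          obtain ⟨y, hy⟩ := smul_choose_defectTerm_mem h hf (by omega) hA (r := 0)
            (c := ((k - 1).factorial : R)) (d := p * (p ^ q * e))
            (by rw [hc]; simp; ring)
          refine ⟨0, (p ^ q * e : R) • y, ?_⟩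
          rw [defectTerm_smul hp.ne', Submodule.coe_smul, smul_smul, ← hy]
          simp [frac_zero]
      have := cartier_sub_simplePole_mem h hf (ω := ⟨_, factorial_smul_frac_mem hk hg⟩)
        (Nat.le_add_left 1 j) hA (c := ((k - 1).factorial : R))
        (by rw [frac_smul, ← hi, frac_mul_pow hf.ne_zero]) (by
          intro r hr
          obtain ⟨d, hd⟩ := prime_mul_factorial_dvd_pow (R := R) h.prime h.ne_two hr
          exact ⟨p ^ j * e * d, by rw [hc, hd, Nat.add_sub_cancel]; ring⟩) g' hg'
      rw [← add_sub_cancel (simplePole p (twist σ f) μ g') (cartier p σ f μ _)]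
      exact Submodule.add_mem_sup ⟨g', rfl⟩ this
    | zero =>
      change cartier p σ f μ (toHat p f μ 0) ∈ _
      rw [map_zero, map_zero]
      exact Submodule.zero_mem _
    | add x y hx hy ihx ihy =>
      change cartier p σ f μ (toHat p f μ (⟨x, hx⟩ + ⟨y, hy⟩)) ∈ _
      rw [map_add, map_add]
      exact Submodule.add_mem _ ihx ihy
    | smul r x hx ih =>
      change cartier p σ f μ (toHat p f μ (r • ⟨x, hx⟩)) ∈ _
      rw [map_smul, map_smul]
      exact Submodule.smul_mem _ _ ih
  obtain ⟨ω, hω⟩ := exists_sub_of_mem x 1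
  obtain ⟨_, ⟨g, rfl⟩, z, hz, e⟩ := Submodule.mem_sup.1 (hsub ω)
  refine ⟨g, ?_⟩
  have h1 := map_mem_pow_smul_top (cartier p σ f μ) hω
  rw [map_sub] at h1
  have h2 := Submodule.add_mem _ h1 hz
  change _ - cartier p σ f μ (toHat p f μ ω) + z ∈ _ at h2
  rwa [← e, sub_add_eq_add_sub, add_sub_add_right_eq_sub] at h2

/-! ### The decomposition `Ω̂_f(μ) = Ω_f(1) ⊕ U_f(μ)` -/

/-- Writing the quotient by `p` over a large power of `f` turns the claim into divisibility of `g`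
times a power of `f`. -/
theorem Ordinary.dvd_of_simplePole_mem (h : OddFrobenius p σ) (hf : Ordinary p μ f)
    (g : numerators R μ) (hg : simplePole p f μ g ∈ pPow p f μ 1) :
    (p : Laurent R n) ∣ g.1 := by
  obtain ⟨y, hy⟩ := mem_span_pow_smul_top_iff.1 (of_mem_iff.1 hg)
  obtain ⟨k₀, hk₀⟩ := hf.exists_frac y.2
  -- The pole order is taken to be the power `p^k₀`, which exceeds `k₀`, to match the exponents in
  -- `Ordinary.dvd_of_dvd_mul_pow`.
  obtain ⟨G, -, hG⟩ := hk₀ _ (Nat.lt_pow_self h.prime.one_lt).le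
  have hM : 1 ≤ p ^ k₀ := Nat.pow_pos h.prime.pos
  have e1 : frac g.1 f 1 = frac ((p : R) • G) f (p ^ k₀) := by
    rw [frac_smul, ← hG]
    simpa using congrArg Subtype.val hy
  rw [frac_eq_iff hf.ne_zero, pow_one] at e1
  have e2 : g.1 * f ^ (p ^ k₀ - 1) = (p : R) • G := by
    refine mul_right_cancel₀ hf.ne_zero ?_
    rw [← e1, mul_assoc, ← pow_succ, Nat.sub_add_cancel hM]
  refine hf.dvd_of_dvd_mul_pow h k₀ g.2 ?_
  rw [e2, natCast_dvd_iff]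
  intro u
  rw [AddMonoidAlgebra.coeff_smul_apply]
  exact dvd_mul_right _ _

theorem cartierIter_succ (s : ℕ) (f : Laurent R n) (x : OmegaHat p f μ) :
    cartierIter p σ μ (s + 1) f x = cartierIter p σ μ s (twist σ f) (cartier p σ f μ x) := rfl

theorem Ordinary.dvd_of_cartierIter_mem (h : OddFrobenius p σ) (s : ℕ) {f : Laurent R n}
    (hf : Ordinary p μ f) (g : numerators R μ)
    (hg : cartierIter p σ μ s f (simplePole p f μ g) ∈ pPow p (twistIter σ s f) μ 1) :
    (p : Laurent R n) ∣ g.1 := by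
  induction s generalizing f g with
  | zero => exact hf.dvd_of_simplePole_mem h g hg
  | succ s ih =>
    refine hf.dvd_of_dvd h.prime.ne_zero g.2 (ih (hf.twisted h.injective)
      ⟨_, hf.cartierPoly_mem h.prime.pos g.2⟩ ?_)
    have h1 := map_mem_pow_smul_top (cartierIter p σ μ s (twist σ f))
      (cartier_simplePole h hf.toAdmissible g)
    rw [map_sub] at h1
    change cartierIter p σ μ s (twist σ f) (cartier p σ f μ _) ∈
      pPow p (twistIter σ s (twist σ f)) μ 1 at hg
    have h2 := Submodule.sub_mem _ hg h1
    rwa [sub_sub_cancel] at h2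

/-- Iterates of `𝒞_p` are injective modulo `p` on simple poles. One factor `p` is removed from `g`
at a time, which is legitimate because the completion has no `p`-torsion. -/
theorem Ordinary.eq_smul_of_cartierIter_mem (h : OddFrobenius p σ) (hf : Ordinary p μ f) (s t : ℕ)
    (g : numerators R μ)
    (hg : cartierIter p σ μ s f (simplePole p f μ g) ∈ pPow p (twistIter σ s f) μ t) :
    ∃ g' : numerators R μ, g = (p : R) ^ t • g' := by
  induction t generalizing g with
  | zero => exact ⟨g, by simp⟩
  | succ t ih =>
    have h1 := hf.dvd_of_cartierIter_mem h s g (pow_smul_top_anti (by omega) hg)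
    obtain ⟨g₁, hg₁⟩ := exists_eq_smul_of_dvd (p := p) (s := 1) g.2
      (by simpa using (natCast_dvd_iff _ _).1 h1)
    change g = _ at hg₁
    rw [hg₁, map_smul, map_smul, add_comm t] at hg
    obtain ⟨g', hg'⟩ := ih g₁ (mem_pow_of_smul_mem (hat_smul_eq_zero h.prime.ne_zero) hg)
    exact ⟨g', by rw [hg₁, hg', smul_smul, ← pow_add, add_comm]⟩

/-- Induction on `s` for all `f` at once: `𝒞_p x` is a simple pole modulo `p`, that pole lifts
through the Hasse–Witt operator, and the error, divided by `p`, is treated by the induction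
hypothesis for `f^σ`. -/
theorem Ordinary.exists_approx (h : OddFrobenius p σ) (s : ℕ) {f : Laurent R n}
    (hf : Ordinary p μ f) (x : OmegaHat p f μ) : ∃ g : numerators R μ, ∀ i ≤ s,
      cartierIter p σ μ i f (x - simplePole p f μ g) ∈ pPow p (twistIter σ i f) μ i := by
  induction s generalizing f with
  | zero =>
    refine ⟨0, fun i hi => ?_⟩
    obtain rfl : i = 0 := by omega
    simp [pPow]
  | succ s ih =>
    have hF := hf.twisted h.injective
    have hlift : ∀ l : numerators R μ, ∃ (g : numerators R μ) (θ : OmegaHat p (twist σ f) μ),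
        cartier p σ f μ (simplePole p f μ g) = simplePole p (twist σ f) μ l + (p : R) • θ := by
      intro l
      obtain ⟨g, hg, he⟩ := hf.exists_cartierPoly_eq h.prime.pos l.2
      obtain ⟨θ, hθ⟩ := mem_span_pow_smul_top_iff.1
        (cartier_simplePole h hf.toAdmissible ⟨g, hg⟩)
      refine ⟨⟨g, hg⟩, θ, ?_⟩
      rw [pow_one, sub_eq_iff_eq_add'] at hθ
      rw [hθ]
      congr 2
      exact Subtype.ext he
    -- Here `ψ` is already good up to level `s`, and `θ` is an uncontrolled error. Each round
    -- approximates `θ` by a simple pole, moves the good remainder into `ψ`, and lifts the pole at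
    -- the cost of a new error with one more factor `p`.
    have key : ∀ t : ℕ, ∃ (g : numerators R μ) (ψ θ : OmegaHat p (twist σ f) μ),
        cartier p σ f μ (x - simplePole p f μ g) = (p : R) • ψ + (p : R) ^ (t + 1) • θ ∧
        ∀ i ≤ s, cartierIter p σ μ i (twist σ f) ψ ∈ pPow p (twistIter σ i (twist σ f)) μ i := by
      intro t
      induction t with
      | zero =>
        obtain ⟨l, hl⟩ := exists_cartier_sub_simplePole_mem h hf.toAdmissible x
        obtain ⟨θ, hθ⟩ := mem_span_pow_smul_top_iff.1 hl
        obtain ⟨g, θ', hg⟩ := hlift l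
        refine ⟨g, 0, θ - θ', ?_, fun i _ => by simp⟩
        rw [sub_eq_iff_eq_add'] at hθ
        rw [map_sub, hθ, hg]
        module
      | succ t iht =>
        obtain ⟨g, ψ, θ, he, hψ⟩ := iht
        obtain ⟨l, hl⟩ := ih hF θ
        obtain ⟨g', θ', hg'⟩ := hlift l
        refine ⟨g + (p : R) ^ (t + 1) • g', ψ + (p : R) ^ t • (θ - simplePole p (twist σ f) μ l),
          -θ', ?_, fun i hi => ?_⟩
        · rw [map_add, map_smul, ← sub_sub, map_sub, he, map_smul, hg']
          simp only [pow_succ]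
          module
        · rw [map_add, map_smul]
          exact Submodule.add_mem _ (hψ i hi) (Submodule.smul_mem _ _ (hl i hi))
    -- After `s` rounds the error carries `p^(s+1)`, enough for every iterate up to `s + 1`.
    obtain ⟨g, ψ, θ, he, hψ⟩ := key s
    refine ⟨g, fun i hi => ?_⟩
    rcases Nat.eq_zero_or_pos i with rfl | hi0
    · simp [pPow]
    · obtain ⟨i, rfl⟩ := Nat.exists_eq_add_of_le' hi0
      rw [cartierIter_succ, he, map_add, map_smul, map_smul]
      refine Submodule.add_mem _ ?_ (pow_smul_top_anti hi (smul_pow_mem _))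
      have := smul_mem_pow_add (a := (p : R)) (t := 1) (hψ i (by omega))
      rwa [pow_one, add_comm 1 i] at this

theorem mem_U_iff {x : OmegaHat p f μ} : x ∈ U p σ f μ ↔
    ∀ s, 1 ≤ s → cartierIter p σ μ s f x ∈ pPow p (twistIter σ s f) μ s := by
  simp [U, Submodule.mem_iInf]

theorem Ordinary.eq_zero_of_simplePole_mem_U (h : OddFrobenius p σ) (hf : Ordinary p μ f)
    {g : numerators R μ} (hg : simplePole p f μ g ∈ U p σ f μ) : g = 0 := by
  refine Subtype.ext (AddMonoidAlgebra.ext (Finsupp.ext fun u => ?_))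
  refine eq_zero_of_forall_mem (a := (p : R)) fun s => ?_
  obtain ⟨g', hg'⟩ := hf.eq_smul_of_cartierIter_mem h _ _ g
    (mem_U_iff.1 hg (s + 1) (Nat.le_add_left 1 s))
  refine pow_smul_top_anti (Nat.le_succ s) (mem_span_pow_smul_top_iff.2 ⟨g'.1.coeff u, ?_⟩)
  rw [hg']
  rfl

/-- Approximations of successive levels differ by a multiple of `p^s`, by injectivity, so their
finitely many coefficients converge in `R`. -/
theorem Ordinary.exists_sub_simplePole_mem_U (h : OddFrobenius p σ) (hf : Ordinary p μ f)
    (x : OmegaHat p f μ) : ∃ g : numerators R μ, x - simplePole p f μ g ∈ U p σ f μ := by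
  choose g hg using fun s => hf.exists_approx h s x
  have hstep : ∀ s, ∃ d : numerators R μ, g (s + 1) - g s = (p : R) ^ s • d := by
    intro s
    refine hf.eq_smul_of_cartierIter_mem h s s _ ?_
    have := Submodule.sub_mem _ (hg s s le_rfl) (hg (s + 1) s (Nat.le_succ s))
    rwa [← map_sub, sub_sub_sub_cancel_left, ← map_sub] at this
  have hL := mem_latticePts hf.isOpen
  have hcauchy : ∀ u : Fin n → ℤ, ∃ c : R, ∀ s, (p : R) ^ s ∣ c - (g s).1.coeff u := by
    intro u
    have hc : ∀ {s t : ℕ}, s ≤ t → (p : R) ^ s ∣ (g s).1.coeff u - (g t).1.coeff u := by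
      intro s t hst
      induction t, hst using Nat.le_induction with
      | base => simp
      | succ t ht ih =>
        obtain ⟨d, hd⟩ := hstep t
        have h1 := congrArg (fun z : numerators R μ => z.1.coeff u) hd
        have h2 : (g (t + 1)).1.coeff u - (g t).1.coeff u = (p : R) ^ t * d.1.coeff u := h1
        have h3 := dvd_sub ih ((pow_dvd_pow _ ht).trans ⟨_, h2⟩)
        rwa [sub_sub, add_sub_cancel] at h3
    obtain ⟨c, hc'⟩ := IsPrecomplete.prec
      (IsAdicComplete.toIsPrecomplete (I := Ideal.span {(p : R)}) (M := R))
      (f := fun s => (g s).1.coeff u) (fun hst => by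
        rw [SModEq.sub_mem]
        obtain ⟨d, hd⟩ := hc hst
        exact mem_span_pow_smul_top_iff.2 ⟨d, hd⟩)
    refine ⟨c, fun s => ?_⟩
    obtain ⟨d, hd⟩ := mem_span_pow_smul_top_iff.1 (SModEq.sub_mem.1 (hc' s).symm)
    exact ⟨d, hd⟩
  choose c hc using hcauchy
  have hmem : ofCoeffs (latticePts f μ) (fun u => c u.1) ∈ numerators R μ :=
    ofCoeffs_mem (fun w => (hL w).1) _
  refine ⟨⟨_, hmem⟩, mem_U_iff.2 fun s _ => ?_⟩
  obtain ⟨d, hd⟩ := exists_eq_smul_of_dvd (p := p) (s := s)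
    (Submodule.sub_mem _ hmem (g s).2) (by
      intro u
      rw [AddMonoidAlgebra.coeff_sub, Finsupp.sub_apply]
      by_cases hu : u ∈ latticePts f μ
      · have := coeff_ofCoeffs (fun u : latticePts f μ => c u.1) ⟨u, hu⟩
        rw [this]
        exact hc u s
      · rw [coeff_eq_zero_of_mem (fun w => (hL w).2) hmem hu,
          coeff_eq_zero_of_mem (fun w => (hL w).2) (g s).2 hu, sub_zero]
        exact dvd_zero _)
  have e : (⟨_, hmem⟩ : numerators R μ) = g s + (p : R) ^ s • d := by
    rw [← hd]; exact Subtype.ext (add_sub_cancel _ _).symm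
  rw [e, map_add, ← sub_sub, map_sub, map_smul, map_smul]
  exact Submodule.sub_mem _ (hg s s le_rfl) (smul_pow_mem _)

theorem sum_smul_omegaElt {L : Finset (Fin n → ℤ)} (hL : ∀ w ∈ L, toReal w ∈ μ) (c : L → R) :
    ∑ w : L, c w • toHat p f μ (omegaElt f (hL w.1 w.2)) =
      simplePole p f μ ⟨ofCoeffs L c, ofCoeffs_mem hL c⟩ := by
  have e : (⟨ofCoeffs L c, ofCoeffs_mem hL c⟩ : numerators R μ) =
      ∑ w : L, c w • ⟨mono w.1 1, suppIn_mono 1 (by simpa using hL w.1 w.2)⟩ := by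
    refine Subtype.ext ?_
    rw [Submodule.coe_sum]
    refine Finset.sum_congr rfl fun w _ => ?_
    simp [mono]
  rw [e, map_sum]
  refine Finset.sum_congr rfl fun w _ => ?_
  rw [map_smul]
  rfl

/-- The set `L` is left free so that forms over `f^σ` can be indexed by the lattice points of `f`.
-/
theorem Ordinary.existsUnique_coeffs (h : OddFrobenius p σ) (hf : Ordinary p μ f)
    {L : Finset (Fin n → ℤ)} (hL : ∀ w, w ∈ L ↔ toReal w ∈ μ) (x : OmegaHat p f μ) :
    ∃! c : L → R, x - ∑ w : L, c w • toHat p f μ (omegaElt f ((hL w.1).1 w.2)) ∈ U p σ f μ := by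
  simp only [sum_smul_omegaElt fun w => (hL w).1]
  obtain ⟨g, hg⟩ := hf.exists_sub_simplePole_mem_U h x
  have hg' : (⟨ofCoeffs L (fun w => g.1.coeff w.1), ofCoeffs_mem (fun w => (hL w).1) _⟩ :
      numerators R μ) = g := Subtype.ext (ofCoeffs_coeff (fun w => (hL w).symm) g.2)
  refine ⟨fun w => g.1.coeff w.1, by simpa only [hg'] using hg, fun c hc => ?_⟩
  have h1 := Submodule.sub_mem _ hg hc
  rw [sub_sub_sub_cancel_left, ← map_sub] at h1
  have h2 := congrArg Subtype.val (sub_eq_zero.1 (hf.eq_zero_of_simplePole_mem_U h h1))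
  funext w
  rw [← coeff_ofCoeffs c w]
  exact congrArg (fun q : Laurent R n => q.coeff w.1) h2

end Decomposition

/-! ### The Gauss norm -/

section GaussNorm

set_option linter.unusedSectionVars false

open scoped NNReal
open UniformSpace

variable {R : Type*} [NormedCommRing R] {n : ℕ}

/-- The Gauss norm of a Laurent polynomial, the maximum of the norms of its coefficients. -/
def gaussNorm (P : Laurent R n) : ℝ≥0 := P.coeff.support.sup fun u => ‖P.coeff u‖₊

theorem gaussNorm_le_iff {P : Laurent R n} {c : ℝ≥0} :
    gaussNorm P ≤ c ↔ ∀ u, ‖P.coeff u‖₊ ≤ c := by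
  rw [gaussNorm, Finset.sup_le_iff]
  refine ⟨fun h u => ?_, fun h u _ => h u⟩
  by_cases hu : P.coeff u = 0
  · simp [hu]
  · exact h u (Finsupp.mem_support_iff.2 hu)

theorem gaussNorm_lt_iff {P : Laurent R n} {c : ℝ≥0} (hc : 0 < c) :
    gaussNorm P < c ↔ ∀ u, ‖P.coeff u‖₊ < c := by
  rw [gaussNorm, Finset.sup_lt_iff (by simpa using hc)]
  refine ⟨fun h u => ?_, fun h u _ => h u⟩
  by_cases hu : P.coeff u = 0
  · simpa [hu] using hc
  · exact h u (Finsupp.mem_support_iff.2 hu)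

theorem nnnorm_coeff_le (P : Laurent R n) (u : Fin n → ℤ) : ‖P.coeff u‖₊ ≤ gaussNorm P :=
  gaussNorm_le_iff.1 le_rfl u

variable [IsUltrametricDist R]

/-- The Gauss norm as a ring norm. -/
def gaussRingNorm (R : Type*) [NormedCommRing R] [IsUltrametricDist R] (n : ℕ) :
    RingNorm (Laurent R n) where
  toFun P := gaussNorm P
  map_zero' := by simp [gaussNorm]
  add_le' P Q := by
    rw [← NNReal.coe_add, NNReal.coe_le_coe, gaussNorm_le_iff]
    exact fun u => (nnnorm_add_le _ _).trans (add_le_add (nnnorm_coeff_le _ _) (nnnorm_coeff_le _ _))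
  neg' P := by simp [gaussNorm]
  mul_le' P Q := by
    rw [← NNReal.coe_mul, NNReal.coe_le_coe, gaussNorm_le_iff]
    intro u
    rw [AddMonoidAlgebra.coeff_mul_apply_left, Finsupp.sum]
    refine IsUltrametricDist.nnnorm_sum_le_of_forall_le fun w _ => (nnnorm_mul_le _ _).trans ?_
    exact mul_le_mul' (nnnorm_coeff_le _ _) (nnnorm_coeff_le _ _)
  eq_zero_of_map_eq_zero' P hP := by
    have h0 : gaussNorm P = 0 := by exact_mod_cast hP
    ext u
    have := nnnorm_coeff_le P u
    rw [h0, nonpos_iff_eq_zero, nnnorm_eq_zero] at this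
    simpa using this

instance instNormedCommRingLaurent : NormedCommRing (Laurent R n) :=
  { (gaussRingNorm R n).toNormedRing with
    mul_comm := mul_comm }

theorem laurent_norm_eq (P : Laurent R n) : ‖P‖ = gaussNorm P := rfl

theorem laurent_nnnorm_eq (P : Laurent R n) : ‖P‖₊ = gaussNorm P := rfl

theorem nnnorm_mono (u : Fin n → ℤ) (c : R) : ‖mono u c‖₊ = ‖c‖₊ := by
  rw [laurent_nnnorm_eq]
  refine le_antisymm (gaussNorm_le_iff.2 fun w => ?_) ?_
  · rw [coeff_mono]
    split_ifs <;> simp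
  · have := nnnorm_coeff_le (mono u c) u
    rwa [coeff_mono, if_pos rfl] at this

/-- The Gauss norm is a maximum over coefficients, so one modulus of continuity serves all of them.
-/
theorem continuous_laurent_map {φ : R →+ R} (hφ : Continuous φ) :
    Continuous (AddMonoidAlgebra.map φ : Laurent R n → Laurent R n) := by
  let Φ : Laurent R n →+ Laurent R n :=
    ⟨⟨AddMonoidAlgebra.map φ, AddMonoidAlgebra.map_zero φ⟩, AddMonoidAlgebra.map_add φ⟩
  refine continuous_of_continuousAt_zero Φ ?_
  have h0 := hφ.continuousAt (x := 0)
  rw [ContinuousAt, map_zero, Metric.tendsto_nhds_nhds] at *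
  intro ε hε
  obtain ⟨η, hη, h⟩ := h0 ε hε
  refine ⟨η, hη, fun {P} hP => ?_⟩
  rw [dist_zero_right] at *
  lift ε to ℝ≥0 using hε.le
  lift η to ℝ≥0 using hη.le
  rw [laurent_norm_eq, NNReal.coe_lt_coe, gaussNorm_lt_iff (by exact_mod_cast hη)] at hP
  rw [laurent_norm_eq, NNReal.coe_lt_coe, gaussNorm_lt_iff (by exact_mod_cast hε)]
  intro u
  have h1 := h (x := P.coeff u) (by rw [dist_zero_right]; exact_mod_cast hP u)
  rw [dist_zero_right] at h1
  exact_mod_cast h1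

/-! ### Convergent Laurent series -/

/-- The ring of `t`-adically convergent Laurent series. -/
abbrev ConvSeries (R : Type*) [NormedCommRing R] [IsUltrametricDist R] (n : ℕ) : Type _ :=
  Completion (Laurent R n)

/-- Laurent polynomials as Laurent series. -/
def toSeries (R : Type*) [NormedCommRing R] [IsUltrametricDist R] (n : ℕ) :
    Laurent R n →+* ConvSeries R n := Completion.coeRingHom

theorem toSeries_apply (P : Laurent R n) : toSeries R n P = (P : ConvSeries R n) := rfl

theorem toCompl_apply (r : R) : toCompl R r = (r : Compl R) := rfl

theorem series_induction {C : ConvSeries R n → Prop} (hC : IsClosed {x | C x})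
    (h : ∀ P, C (toSeries R n P)) (x : ConvSeries R n) : C x :=
  Completion.induction_on x hC h

/-- The constant coefficient of a Laurent polynomial. -/
def coeffZero (R : Type*) [NormedCommRing R] (n : ℕ) : Laurent R n →+ R where
  toFun P := P.coeff 0
  map_zero' := rfl
  map_add' _ _ := rfl

theorem continuous_coeffZero : Continuous (coeffZero R n) :=
  AddMonoidHomClass.continuous_of_bound _ 1 fun P => by
    rw [one_mul, laurent_norm_eq]
    exact_mod_cast nnnorm_coeff_le P 0

/-- The constant coefficient of a Laurent series. -/
def constCoeff (R : Type*) [NormedCommRing R] [IsUltrametricDist R] (n : ℕ) :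
    ConvSeries R n →+ Compl R :=
  (coeffZero R n).completion continuous_coeffZero

theorem continuous_constCoeff : Continuous (constCoeff R n) :=
  AddMonoidHom.continuous_completion _ _

theorem constCoeff_toSeries (P : Laurent R n) :
    constCoeff R n (toSeries R n P) = toCompl R (P.coeff 0) :=
  AddMonoidHom.completion_coe _ _ _

/-- Constants as Laurent polynomials. -/
def constHom (R : Type*) [NormedCommRing R] (n : ℕ) : R →+* Laurent R n :=
  AddMonoidAlgebra.singleZeroRingHom

theorem norm_constHom (r : R) : ‖constHom R n r‖ = ‖r‖ := congrArg NNReal.toReal (nnnorm_mono 0 r)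

theorem continuous_constHom : Continuous (constHom R n) :=
  AddMonoidHomClass.continuous_of_bound _ 1 fun P => by rw [one_mul, norm_constHom]

/-- Constants as Laurent series. -/
def constSeries (R : Type*) [NormedCommRing R] [IsUltrametricDist R] (n : ℕ) :
    Compl R →+* ConvSeries R n := Completion.mapRingHom (constHom R n) continuous_constHom

theorem continuous_constSeries : Continuous (constSeries R n) := Completion.continuous_map

theorem constSeries_toCompl (r : R) : constSeries R n (toCompl R r) = toSeries R n (mono 0 r) :=
  Completion.mapRingHom_coe _ _

theorem norm_constSeries_le (s : Compl R) : ‖constSeries R n s‖ ≤ ‖s‖ := by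
  induction s using Completion.induction_on with
  | hp => exact isClosed_le continuous_constSeries.norm continuous_norm
  | ih r =>
    rw [← toCompl_apply, constSeries_toCompl, toSeries_apply, toCompl_apply, Completion.norm_coe,
      Completion.norm_coe]
    exact (norm_constHom r).le

theorem constCoeff_constSeries_mul (s : Compl R) (x : ConvSeries R n) :
    constCoeff R n (constSeries R n s * x) = s * constCoeff R n x := by
  induction s using Completion.induction_on with
  | hp =>
    exact isClosed_eq (continuous_constCoeff.comp (continuous_constSeries.mul continuous_const))
      (continuous_id.mul continuous_const)
  | ih r =>
    induction x using series_induction with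
    | hC =>
      exact isClosed_eq (continuous_constCoeff.comp (continuous_const.mul continuous_id))
        (continuous_const.mul continuous_constCoeff)
    | h P =>
      rw [← toCompl_apply, constSeries_toCompl, ← map_mul, constCoeff_toSeries,
        constCoeff_toSeries, coeff_mono_mul, map_mul, sub_zero]

theorem constCoeff_toSeries_smul_mul (r : R) (P : Laurent R n) (x : ConvSeries R n) :
    constCoeff R n (toSeries R n (r • P) * x) =
      toCompl R r * constCoeff R n (toSeries R n P * x) := by
  have : r • P = mono 0 r * P := by
    ext u; rw [coeff_mono_mul, sub_zero, AddMonoidAlgebra.coeff_smul_apply, smul_eq_mul]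
  rw [this, (toSeries R n).map_mul, ← constSeries_toCompl, mul_assoc, constCoeff_constSeries_mul]

theorem continuous_substPow (p : ℕ) :
    Continuous (AddMonoidAlgebra.mapDomainRingHom R (nsmulAddMonoidHom (α := Fin n → ℤ) p)) := by
  classical
  refine AddMonoidHomClass.continuous_of_bound _ 1 fun P => ?_
  rw [one_mul, laurent_norm_eq, laurent_norm_eq, NNReal.coe_le_coe, gaussNorm_le_iff]
  intro u
  change ‖(Finsupp.mapDomain _ P.coeff) u‖₊ ≤ _
  rw [Finsupp.mapDomain, Finsupp.sum_apply, Finsupp.sum]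
  refine IsUltrametricDist.nnnorm_sum_le_of_forall_le fun w _ => ?_
  rw [Finsupp.single_apply]
  split_ifs
  · exact nnnorm_coeff_le _ _
  · simp

/-- The substitution `x ↦ x ^ p` on Laurent series. -/
def substSeries (R : Type*) [NormedCommRing R] [IsUltrametricDist R] (n p : ℕ) :
    ConvSeries R n →+* ConvSeries R n :=
  Completion.mapRingHom _ (continuous_substPow p)

theorem substSeries_toSeries (p : ℕ) (P : Laurent R n) :
    substSeries R n p (toSeries R n P) = toSeries R n (substPow p P) :=
  Completion.mapRingHom_coe _ _

/-- Invariance of constant terms in its basic form: the projection formula at exponent zero,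
extended by density. -/
theorem constCoeff_mul_substSeries {p : ℕ} (hp : p ≠ 0) (B : Laurent R n)
    (x : ConvSeries R n) :
    constCoeff R n (toSeries R n B * substSeries R n p x) =
      constCoeff R n (toSeries R n (cartierPoly p B) * x) := by
  induction x using series_induction with
  | hC =>
    exact isClosed_eq (continuous_constCoeff.comp (continuous_const.mul Completion.continuous_map))
      (continuous_constCoeff.comp (continuous_const.mul continuous_id))
  | h P =>
    rw [substSeries_toSeries, ← map_mul, ← map_mul, constCoeff_toSeries, constCoeff_toSeries,
      ← cartierPoly_mul_substPow hp, coeff_cartierPoly hp, smul_zero]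

end GaussNorm

/-! ### Laurent polynomials with a dominant term -/

section Dominant

open UniformSpace

set_option linter.unusedSectionVars false

variable {R : Type*} [NormedCommRing R] [NormMulClass R] [IsUltrametricDist R] {n : ℕ}

theorem norm_toCompl_mul (r : R) (s : Compl R) : ‖toCompl R r * s‖ = ‖r‖ * ‖s‖ := by
  induction s using Completion.induction_on with
  | hp =>
    exact isClosed_eq (continuous_const.mul continuous_id).norm
      (continuous_const.mul continuous_norm)
  | ih x =>
    rw [← toCompl_apply, ← map_mul, toCompl_apply, toCompl_apply, Completion.norm_coe,
      Completion.norm_coe, norm_mul]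

/-- The evaluation of Laurent polynomials over the completion as Laurent series. -/
def complToSeries (R : Type*) [NormedCommRing R] [IsUltrametricDist R] (n : ℕ) :
    Laurent (Compl R) n →+* ConvSeries R n :=
  AddMonoidAlgebra.liftNCRingHom (constSeries R n)
    ((toSeries R n).toMonoidHom.comp (AddMonoidAlgebra.of R (Fin n → ℤ))) fun _ _ => Commute.all _ _

theorem complToSeries_mono (u : Fin n → ℤ) (s : Compl R) :
    complToSeries R n (mono u s) = constSeries R n s * toSeries R n (mono u 1) :=
  AddMonoidAlgebra.liftNC_single _ _ _ _

theorem toSeries_mono (u : Fin n → ℤ) (r : R) :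
    toSeries R n (mono u r) = constSeries R n (toCompl R r) * toSeries R n (mono u 1) := by
  rw [constSeries_toCompl, ← map_mul, mono_mul_mono, zero_add, mul_one]

theorem complToSeries_map (g : Laurent R n) :
    complToSeries R n (AddMonoidAlgebra.mapRingHom (Fin n → ℤ) (toCompl R) g) = toSeries R n g := by
  induction g using laurent_induction with
  | h0 => simp only [map_zero]
  | hs u c =>
    rw [toSeries_mono, ← complToSeries_mono]
    exact congrArg _ (AddMonoidAlgebra.map_single _ _ _)
  | ha x y hx hy => simp only [map_add, hx, hy]

theorem constCoeff_complToSeries (P : Laurent (Compl R) n) :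
    constCoeff R n (complToSeries R n P) = P.coeff 0 := by
  induction P using laurent_induction with
  | h0 => simp only [map_zero]; rfl
  | hs u c =>
    rw [complToSeries_mono, constCoeff_constSeries_mul, constCoeff_toSeries, coeff_mono, coeff_mono]
    split_ifs <;> simp
  | ha x y hx hy => rw [map_add, map_add, hx, hy]; rfl

/-- The coefficient of `x^v` strictly dominates the others and is a unit of the completion. -/
structure Dominant (v : Fin n → ℤ) (f : Laurent R n) : Prop where
  lt : ∀ w, w ≠ v → ‖f.coeff w‖ < ‖f.coeff v‖
  isUnit : IsUnit (toCompl R (f.coeff v))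

variable {v : Fin n → ℤ} {f : Laurent R n}

/-- The sum of the terms of `f` other than that of `x^v`. -/
def restPart (f : Laurent R n) (v : Fin n → ℤ) : Laurent R n :=
  ∑ w ∈ f.coeff.support.erase v, mono w (f.coeff w)

theorem coeff_restPart (u : Fin n → ℤ) :
    (restPart f v).coeff u = if u = v then 0 else f.coeff u := by
  rw [restPart, AddMonoidAlgebra.coeff_sum, Finsupp.finsetSum_apply]
  simp only [coeff_mono]
  rw [Finset.sum_ite_eq']
  split_ifs with h1 h2 h2
  · exact absurd h2 (Finset.mem_erase.1 h1).1
  · rfl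
  · rfl
  · rw [Finset.mem_erase, not_and] at h1
    exact (Finsupp.notMem_support_iff.1 (h1 h2)).symm

theorem mono_add_restPart : mono v (f.coeff v) + restPart f v = f := by
  ext u
  rw [AddMonoidAlgebra.coeff_add, Finsupp.add_apply, coeff_mono, coeff_restPart]
  by_cases h : u = v
  · subst h; simp
  · simp [h, Ne.symm h]

/-- The inverse of the leading term of `f` as a Laurent series. -/
def leadInv (f : Laurent R n) (v : Fin n → ℤ) : ConvSeries R n :=
  constSeries R n (Ring.inverse (toCompl R (f.coeff v))) * toSeries R n (mono (-v) 1)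

theorem complToSeries_smallPart :
    complToSeries R n (smallPart f v) = leadInv f v * toSeries R n (restPart f v) := by
  rw [smallPart, restPart, map_sum, map_sum, Finset.mul_sum]
  refine Finset.sum_congr rfl fun w _ => ?_
  have e : (mono (w - v) 1 : Laurent R n) = mono w 1 * mono (-v) 1 := by
    rw [mono_mul_mono, one_mul, sub_eq_add_neg]
  rw [complToSeries_mono, toSeries_mono w, e, leadInv, map_mul, map_mul]
  ring

namespace Dominant

theorem leadInv_mul_mono (hd : Dominant v f) :
    leadInv f v * toSeries R n (mono v (f.coeff v)) = 1 := by
  have e : (1 : Laurent R n) = mono (-v) 1 * mono v 1 := by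
    rw [mono_mul_mono, neg_add_cancel, one_mul]; rfl
  rw [toSeries_mono, leadInv, mul_mul_mul_comm, ← map_mul, Ring.inverse_mul_cancel _ hd.isUnit,
    ← map_mul, ← e, map_one, map_one, one_mul]

/-- The norm of the leading coefficient times that of its inverse is exactly `1`, by
multiplicativity, so strict dominance makes the ratio small. -/
theorem norm_leadInv_mul_lt (hd : Dominant v f) :
    ‖leadInv f v * toSeries R n (restPart f v)‖ < 1 := by
  rcases subsingleton_or_nontrivial R with hR | hR
  · have : leadInv f v * toSeries R n (restPart f v) = 0 := by
      rw [Subsingleton.elim (restPart f v) 0, map_zero, mul_zero]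
    rw [this, norm_zero]; exact one_pos
  have := NormMulClass.toNormOneClass (α := R)
  have h1 : ‖f.coeff v‖ * ‖Ring.inverse (toCompl R (f.coeff v))‖ = 1 := by
    rw [← norm_toCompl_mul, Ring.mul_inverse_cancel _ hd.isUnit, ← map_one (toCompl R),
      toCompl_apply, Completion.norm_coe, norm_one]
  have h0 : 0 < ‖f.coeff v‖ := by
    refine lt_of_le_of_ne (norm_nonneg _) fun h => ?_
    rw [← h, zero_mul] at h1
    exact zero_ne_one h1
  have h2 : ‖restPart f v‖ < ‖f.coeff v‖ := by
    rw [laurent_norm_eq, ← coe_nnnorm, NNReal.coe_lt_coe, gaussNorm_lt_iff (by exact_mod_cast h0)]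
    intro u
    rw [coeff_restPart]
    split_ifs with h
    · rw [nnnorm_zero]; exact_mod_cast h0
    · exact_mod_cast hd.lt u h
  have h3 : ‖toSeries R n (mono (-v) 1)‖ = 1 := by
    rw [toSeries_apply, Completion.norm_coe, ← coe_nnnorm, nnnorm_mono, coe_nnnorm, norm_one]
  have h4 : ‖leadInv f v‖ ≤ ‖Ring.inverse (toCompl R (f.coeff v))‖ := by
    refine (norm_mul_le _ _).trans ?_
    rw [h3, mul_one]
    exact norm_constSeries_le _
  have h5 : 0 < ‖Ring.inverse (toCompl R (f.coeff v))‖ := by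
    refine lt_of_le_of_ne (norm_nonneg _) fun h => ?_
    rw [← h, mul_zero] at h1
    exact zero_ne_one h1
  calc _ ≤ ‖leadInv f v‖ * ‖toSeries R n (restPart f v)‖ := norm_mul_le _ _
    _ ≤ ‖Ring.inverse (toCompl R (f.coeff v))‖ * ‖restPart f v‖ := by
        rw [toSeries_apply, Completion.norm_coe]
        exact mul_le_mul_of_nonneg_right h4 (norm_nonneg _)
    _ < ‖Ring.inverse (toCompl R (f.coeff v))‖ * ‖f.coeff v‖ := by gcongr
    _ = 1 := by rw [mul_comm, h1]

/-- The geometric series for the inverse of `f`. -/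
theorem exists_inverse (hd : Dominant v f) :
    ∃ G : ConvSeries R n, toSeries R n f * (leadInv f v * G) = 1 ∧
      HasSum (fun r => (-(leadInv f v * toSeries R n (restPart f v))) ^ r) G := by
  have hy : ‖-(leadInv f v * toSeries R n (restPart f v))‖ < 1 := by
    rw [norm_neg]; exact hd.norm_leadInv_mul_lt
  refine ⟨_, ?_, hasSum_geom_series_inverse _ hy⟩
  have h1 := hd.leadInv_mul_mono
  have h2 := Ring.mul_inverse_cancel _ (isUnit_one_sub_of_norm_lt_one hy)
  have h3 : toSeries R n f * leadInv f v =
      1 - -(leadInv f v * toSeries R n (restPart f v)) := by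
    have h4 := congrArg (toSeries R n) (mono_add_restPart (f := f) (v := v))
    rw [map_add] at h4
    rw [← h4]
    linear_combination h1
  rw [← mul_assoc, h3, h2]

theorem isUnit_toSeries (hd : Dominant v f) : IsUnit (toSeries R n f) := by
  obtain ⟨J, hJ, -⟩ := hd.exists_inverse
  exact IsUnit.of_mul_eq_one _ hJ

end Dominant

/-- The inverse of `f` as a Laurent series. -/
def invSeries (f : Laurent R n) : ConvSeries R n := Ring.inverse (toSeries R n f)

theorem Dominant.mul_invSeries (hd : Dominant v f) : toSeries R n f * invSeries f = 1 :=
  Ring.mul_inverse_cancel _ hd.isUnit_toSeries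

/-- The constant coefficient of the Laurent series of `g / f ^ k`. -/
def seriesPeriod (f g : Laurent R n) (k : ℕ) : Compl R :=
  constCoeff R n (toSeries R n g * invSeries f ^ k)

/-- For `k = 1` the binomial coefficients are signs and the expansion is the geometric series for `1
/ f`. Higher pole orders are handled through powers of the inverse, so this case is the only
comparison required. -/
theorem Dominant.periodMap_one (hd : Dominant v f) (g : Laurent R n) :
    periodMap f v g 1 = seriesPeriod f g 1 := by
  obtain ⟨G, hG, hs⟩ := hd.exists_inverse
  have hJ : invSeries f = leadInv f v * G := by
    rw [← one_mul (invSeries f), ← hG, mul_right_comm, hd.mul_invSeries, one_mul]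
  have h1 := ((hs.mul_left (toSeries R n (g * mono (-v) 1))).map (constCoeff R n)
    continuous_constCoeff).tsum_eq
  rw [seriesPeriod, pow_one, hJ, leadInv, mul_assoc, mul_left_comm, constCoeff_constSeries_mul,
    ← mul_assoc, ← map_mul, ← h1, periodMap, expansionCoeff, pow_one]
  refine congrArg _ (tsum_congr fun r => ?_)
  rw [← constCoeff_complToSeries, (complToSeries R n).map_mul, (complToSeries R n).map_mul,
    map_pow, complToSeries_map,
    complToSeries_smallPart, complToSeries_mono, map_one, one_mul, one_smul, add_tsub_cancel_left,
    Nat.choose_self, Nat.cast_one, mul_one, ← constCoeff_constSeries_mul, map_pow, map_neg, map_one,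
    Function.comp_apply, (toSeries R n).map_mul]
  congr 1
  rw [neg_pow (leadInv f v * _)]
  ring

end Dominant

/-! ### Periods and the Cartier operator -/

/-- The binomial expansion of `K ^ m = (Φ + h) ^ (-m)` in powers of `h`. -/
theorem exists_pow_sub_binomial_eq {A : Type*} [CommRing A] {K W Φ h : A} (hK : K * (Φ + h) = 1)
    (hW : W * Φ = 1) (m N : ℕ) :
    ∃ z, K ^ m - ∑ r ∈ Finset.range (N + 1),
      ((-1 : A) ^ r * ((m + r - 1).choose r : A)) • (h ^ r * W ^ (m + r)) = h ^ (N + 1) * z := by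
  induction m with
  | zero =>
    refine ⟨0, ?_⟩
    rw [Finset.sum_eq_single_of_mem 0 (by simp)]
    · simp
    · intro r _ hr
      rw [Nat.choose_eq_zero_of_lt (by omega)]
      simp
  | succ m ih =>
    obtain ⟨z, hz⟩ := ih
    have h1 := binomial_telescope (R := A) (fun r => h ^ r * W ^ (m + r)) m N
    have h2 : ∀ r, h ^ r * W ^ (m + r) + h ^ (r + 1) * W ^ (m + (r + 1)) =
        h ^ r * W ^ (m + 1 + r) * (Φ + h) := fun r => by
      linear_combination (-(h ^ r * W ^ (m + r))) * hW
    simp only [h2, smul_eq_mul, ← mul_assoc, ← Finset.sum_mul] at h1 hz ⊢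
    -- As `K (Φ + h) = 1`, the new remainder is `K` times the difference of `K^m` and `S (Φ + h)`;
    -- the telescoping identity expresses the latter by the old sum and one boundary term.
    refine ⟨K * z - K * ((-1) ^ N * ((m + N).choose N : A) * W ^ (m + (N + 1))), ?_⟩
    set S := ∑ r ∈ Finset.range (N + 1),
      (-1) ^ r * ((m + 1 + r - 1).choose r : A) * h ^ r * W ^ (m + 1 + r)
    linear_combination K * hz - K * h1 + S * hK

section PeriodHom

open UniformSpace

set_option linter.unusedSectionVars false

variable {R : Type*} [NormedCommRing R] [NormMulClass R] [IsUltrametricDist R] [IsDomain R] {n : ℕ}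
  {v : Fin n → ℤ} {f : Laurent R n}

theorem smul_compl (r : R) (s : Compl R) : r • s = toCompl R r * s := Algebra.smul_def r s

theorem seriesPeriod_add (f g h : Laurent R n) (k : ℕ) :
    seriesPeriod f (g + h) k = seriesPeriod f g k + seriesPeriod f h k := by
  rw [seriesPeriod, map_add, add_mul, map_add]; rfl

theorem seriesPeriod_smul (r : R) (f g : Laurent R n) (k : ℕ) :
    seriesPeriod f (r • g) k = r • seriesPeriod f g k := by
  rw [seriesPeriod, constCoeff_toSeries_smul_mul, smul_compl]; rfl

theorem seriesPeriod_zero (f : Laurent R n) (k : ℕ) : seriesPeriod f 0 k = 0 := by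
  rw [seriesPeriod, map_zero, zero_mul, map_zero]

namespace Dominant

theorem ne_zero (hd : Dominant v f) : f ≠ 0 := by
  rintro rfl
  obtain ⟨x, hx⟩ := hd.isUnit
  have h0 : (x : Compl R) = 0 := by rw [hx]; exact map_zero _
  have h1 := norm_toCompl_mul (1 : R) (x : Compl R)
  have h2 : (1 : Compl R) = 0 := by rw [← x.mul_inv, h0, zero_mul]
  have h3 : ‖(1 : R)‖ = 0 := by
    rw [← Completion.norm_coe, ← toCompl_apply, map_one, h2, norm_zero]
  exact one_ne_zero (norm_eq_zero.1 h3)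

theorem seriesPeriod_mul_pow (hd : Dominant v f) (g : Laurent R n) (k j : ℕ) :
    seriesPeriod f (g * f ^ j) (k + j) = seriesPeriod f g k := by
  have h : toSeries R n (g * f ^ j) * invSeries f ^ (k + j) =
      toSeries R n g * invSeries f ^ k * (toSeries R n f * invSeries f) ^ j := by
    rw [map_mul, map_pow]; ring
  rw [seriesPeriod, h, hd.mul_invSeries, one_pow, mul_one]; rfl

end Dominant

/-- `s` is the period of the rational function `x`, written with a power of `f` as denominator. -/
def IsPeriod (f : Laurent R n) (x : RatFun R n) (s : Compl R) : Prop :=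
  ∃ g k, x = frac g f k ∧ s = seriesPeriod f g k

theorem isPeriod_frac (f g : Laurent R n) (k : ℕ) : IsPeriod f (frac g f k) (seriesPeriod f g k) :=
  ⟨g, k, rfl, rfl⟩

namespace IsPeriod

variable {x y : RatFun R n} {s t : Compl R}

theorem unique (hd : Dominant v f) (hs : IsPeriod f x s) (ht : IsPeriod f x t) : s = t := by
  obtain ⟨g, k, rfl, rfl⟩ := hs
  obtain ⟨h, l, hx, rfl⟩ := ht
  rw [← hd.seriesPeriod_mul_pow g k l, ← hd.seriesPeriod_mul_pow h l k,
    (frac_eq_iff hd.ne_zero).1 hx, add_comm]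

theorem smul (r : R) (hs : IsPeriod f x s) : IsPeriod f (r • x) (r • s) := by
  obtain ⟨g, k, rfl, rfl⟩ := hs
  exact ⟨r • g, k, (frac_smul r g f k).symm, (seriesPeriod_smul r f g k).symm⟩

theorem add (hd : Dominant v f) (hs : IsPeriod f x s) (ht : IsPeriod f y t) :
    IsPeriod f (x + y) (s + t) := by
  obtain ⟨g, k, rfl, rfl⟩ := hs
  obtain ⟨h, l, rfl, rfl⟩ := ht
  refine ⟨g * f ^ l + h * f ^ k, k + l, ?_, ?_⟩
  · rw [frac_add, frac_mul_pow hd.ne_zero, add_comm k, frac_mul_pow hd.ne_zero]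
  · rw [seriesPeriod_add, hd.seriesPeriod_mul_pow, add_comm k, hd.seriesPeriod_mul_pow]

theorem zero (f : Laurent R n) : IsPeriod f 0 0 :=
  ⟨0, 0, (frac_zero f 0).symm, (seriesPeriod_zero f 0).symm⟩

theorem sum (hd : Dominant v f) {ι : Type*} (S : Finset ι) {x : ι → RatFun R n} {s : ι → Compl R}
    (h : ∀ i, IsPeriod f (x i) (s i)) : IsPeriod f (∑ i ∈ S, x i) (∑ i ∈ S, s i) := by
  classical
  induction S using Finset.induction_on with
  | empty => exact zero f
  | insert i S hi ih =>
    rw [Finset.sum_insert hi, Finset.sum_insert hi]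
    exact (h i).add hd ih

end IsPeriod

theorem Dominant.exists_periodHom (hd : Dominant v f) (μ : Set (Fin n → ℝ)) :
    ∃ P : Omega f μ →ₗ[R] Compl R, ∀ ω : Omega f μ, IsPeriod f ω (P ω) := by
  have h : ∀ ω : Omega f μ, ∃ s, IsPeriod f (ω : RatFun R n) s := by
    rintro ⟨ω, hω⟩
    change ∃ s, IsPeriod f ω s
    induction hω using Submodule.span_induction with
    | mem x hx =>
      obtain ⟨k, g, -, -, rfl⟩ := hx
      exact ⟨_, (isPeriod_frac f g k).smul _⟩
    | zero => exact ⟨0, IsPeriod.zero f⟩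
    | add x y _ _ hx hy =>
      obtain ⟨s, hs⟩ := hx
      obtain ⟨t, ht⟩ := hy
      exact ⟨_, hs.add hd ht⟩
    | smul r x _ hx =>
      obtain ⟨s, hs⟩ := hx
      exact ⟨_, hs.smul r⟩
  choose P hP using h
  exact ⟨{ toFun := P
           map_add' := fun ω θ => IsPeriod.unique hd (hP (ω + θ)) ((hP ω).add hd (hP θ))
           map_smul' := fun r ω => IsPeriod.unique hd (hP (r • ω)) ((hP ω).smul r) }, hP⟩

/-- The period map on `Ω_f(μ)`. -/
def Dominant.periodHom (hd : Dominant v f) (μ : Set (Fin n → ℝ)) : Omega f μ →ₗ[R] Compl R :=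
  (hd.exists_periodHom μ).choose

theorem Dominant.periodHom_eq (hd : Dominant v f) {μ : Set (Fin n → ℝ)} {ω : Omega f μ}
    {s : Compl R} (hs : IsPeriod f (ω : RatFun R n) s) : hd.periodHom μ ω = s :=
  ((hd.exists_periodHom μ).choose_spec ω).unique hd hs

variable {p : ℕ} {σ : R →+* R} {μ : Set (Fin n → ℝ)}

/-- The same binomial expansion, carried out in the ring of series with `Φ = f^σ(x^p)`: its
remainder is a multiple of `H^(N+1)`, hence of `p^(N+1)`. -/
theorem seriesPeriod_sub_mem (h : OddFrobenius p σ) (hd : Dominant v f)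
    (hdσ : Dominant v (twist σ f)) (A : Laurent R n) (m N : ℕ) :
    seriesPeriod f A (p * m) - ∑ r ∈ Finset.range (N + 1),
      ((-1 : R) ^ r * ((m + r - 1).choose r : R)) •
        seriesPeriod (twist σ f) (cartierPoly p (A * frobDefect p σ f ^ r)) (m + r)
      ∈ (Ideal.span {(p : R)} ^ (N + 1) • ⊤ : Submodule R (Compl R)) := by
  obtain ⟨H, hH⟩ := dvd_frobDefect h.prime h.lift f
  have hK : invSeries f ^ p * (toSeries R n (substPow p (twist σ f)) +
      toSeries R n (frobDefect p σ f)) = 1 := by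
    rw [← map_add, ← pow_eq_substPow_add, map_pow, ← mul_pow, mul_comm, hd.mul_invSeries, one_pow]
  have hW : substSeries R n p (invSeries (twist σ f)) *
      toSeries R n (substPow p (twist σ f)) = 1 := by
    rw [← substSeries_toSeries, ← map_mul, mul_comm, hdσ.mul_invSeries, map_one]
  obtain ⟨z, hz⟩ := exists_pow_sub_binomial_eq hK hW m N
  have e : seriesPeriod f A (p * m) - ∑ r ∈ Finset.range (N + 1),
      ((-1 : R) ^ r * ((m + r - 1).choose r : R)) •
        seriesPeriod (twist σ f) (cartierPoly p (A * frobDefect p σ f ^ r)) (m + r) =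
      constCoeff R n (toSeries R n A * (toSeries R n (frobDefect p σ f) ^ (N + 1) * z)) := by
    rw [← hz, mul_sub, map_sub, ← pow_mul, Finset.mul_sum, map_sum]
    refine congrArg₂ _ rfl (Finset.sum_congr rfl fun r _ => ?_)
    rw [seriesPeriod, ← constCoeff_mul_substSeries h.prime.ne_zero, smul_compl,
      ← constCoeff_constSeries_mul]
    congr 1
    simp only [map_mul, map_pow, map_neg, map_one, map_natCast, smul_eq_mul]
    ring
  rw [e, hH]
  refine mem_span_pow_smul_top_iff.2
    ⟨constCoeff R n (toSeries R n A * (toSeries R n H ^ (N + 1) * z)), ?_⟩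
  rw [smul_compl, ← constCoeff_constSeries_mul]
  congr 1
  simp only [map_mul, map_pow, map_natCast]
  ring

/-- The target is the `p`-adic completion of `S`, because `S` itself is only assumed `p`-adically
separated. -/
theorem Dominant.exists_periodHat (hd : Dominant v f) (p : ℕ) (μ : Set (Fin n → ℝ)) :
    ∃ P : OmegaHat p f μ →ₗ[R] AdicCompletion (Ideal.span {(p : R)}) (Compl R),
      ∀ ω, P (toHat p f μ ω) = AdicCompletion.of _ _ (hd.periodHom μ ω) :=
  exists_hat_lift (AdicCompletion.of _ _ ∘ₗ hd.periodHom μ)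

/-- The period map on the completion of `Ω_f(μ)`. -/
def Dominant.periodHat (hd : Dominant v f) (p : ℕ) (μ : Set (Fin n → ℝ)) :
    OmegaHat p f μ →ₗ[R] AdicCompletion (Ideal.span {(p : R)}) (Compl R) :=
  (hd.exists_periodHat p μ).choose

theorem Dominant.periodHat_toHat (hd : Dominant v f) (ω : Omega f μ) :
    hd.periodHat p μ (toHat p f μ ω) = AdicCompletion.of _ _ (hd.periodHom μ ω) :=
  (hd.exists_periodHat p μ).choose_spec ω

variable [CharZero R] [IsAdicComplete (Ideal.span {(p : R)}) R]

/-- Modulo each `p^s`, `𝒞_p ω` is a partial sum whose period agrees with that of `ω`; density of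
`Ω_f(μ)` does the rest. -/
theorem Dominant.periodHat_comp_cartier (h : OddFrobenius p σ) (hf : Admissible μ f)
    (hd : Dominant v f) (hdσ : Dominant v (twist σ f)) :
    hdσ.periodHat p μ ∘ₗ cartier p σ f μ = hd.periodHat p μ := by
  refine hat_hom_ext (a := (p : R)) fun ω => ?_
  rw [← sub_eq_zero]
  refine eq_zero_of_forall_mem (a := (p : R)) fun s => ?_
  obtain ⟨k₀, hk₀⟩ := hf.exists_frac ω.2
  obtain ⟨A, hA, hω⟩ := hk₀ (p * (k₀ + 1)) (by nlinarith [h.prime.pos])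
  obtain ⟨N₀, hN₀⟩ := convTo_cartier h hf ω (Nat.le_add_left 1 k₀) hA hω s
  obtain ⟨e, he, hm⟩ := hN₀ (max N₀ s + 1) ((le_max_left _ _).trans (Nat.le_succ _))
  have h1 := map_mem_pow_smul_top (hdσ.periodHat p μ) hm
  have h2 : hdσ.periodHom μ e = _ := hdσ.periodHom_eq (by
    rw [he]
    exact IsPeriod.sum hdσ _ fun r => (isPeriod_frac _ _ _).smul _)
  have h3 := pow_smul_top_anti ((le_max_right N₀ s).trans (Nat.le_succ _))
    (seriesPeriod_sub_mem h hd hdσ A (k₀ + 1) (max N₀ s))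
  have h5 : hd.periodHom μ ω = seriesPeriod f A (p * (k₀ + 1)) :=
    hd.periodHom_eq (by rw [hω]; exact isPeriod_frac _ _ _)
  rw [← h2, ← h5, ← of_mem_iff, map_sub,
    ← hd.periodHat_toHat, ← hdσ.periodHat_toHat] at h3
  rw [map_sub] at h1
  have h4 := Submodule.sub_mem _ h1 h3
  rwa [sub_sub_sub_cancel_right] at h4

theorem twistIter_dominant (hσ : ∀ g : Laurent R n, Dominant v g → Dominant v (twist σ g)) (s : ℕ)
    (hd : Dominant v f) : Dominant v (twistIter σ s f) := by
  induction s generalizing f with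
  | zero => exact hd
  | succ s ih => exact ih (hσ f hd)

theorem twistIter_admissible (hσ : Function.Injective σ) (s : ℕ) (hf : Admissible μ f) :
    Admissible μ (twistIter σ s f) := by
  induction s generalizing f with
  | zero => exact hf
  | succ s ih => exact ih (hf.twisted hσ)

theorem Dominant.periodHat_cartierIter (h : OddFrobenius p σ)
    (hσ : ∀ g : Laurent R n, Dominant v g → Dominant v (twist σ g)) (s : ℕ) (hf : Admissible μ f)
    (hd : Dominant v f) (hd' : Dominant v (twistIter σ s f)) (x : OmegaHat p f μ) :
    hd'.periodHat p μ (cartierIter p σ μ s f x) = hd.periodHat p μ x := by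
  induction s generalizing f with
  | zero => rfl
  | succ s ih =>
    have h1 := ih (hf.twisted h.injective) (hσ f hd) hd' (cartier p σ f μ x)
    have h2 := LinearMap.congr_fun (Dominant.periodHat_comp_cartier h hf hd (hσ f hd)) x
    exact h1.trans h2

/-- Periods vanish on `U_f(μ)`. -/
theorem Dominant.periodHat_eq_zero (h : OddFrobenius p σ)
    (hσ : ∀ g : Laurent R n, Dominant v g → Dominant v (twist σ g)) (hf : Admissible μ f)
    (hd : Dominant v f) {x : OmegaHat p f μ} (hx : x ∈ U p σ f μ) : hd.periodHat p μ x = 0 := by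
  refine eq_zero_of_forall_mem (a := (p : R)) fun s => pow_smul_top_anti (Nat.le_succ s) ?_
  have hd' := twistIter_dominant hσ (s + 1) hd
  have h2 := mem_U_iff.1 hx (s + 1) (Nat.le_add_left 1 s)
  rw [← Dominant.periodHat_cartierIter h hσ (s + 1) hf hd hd']
  exact map_mem_pow_smul_top (hd'.periodHat p μ) h2

theorem isHausdorff_compl
    (hS : ∀ x : Compl R, (∀ s : ℕ, (p : Compl R) ^ s ∣ x) → x = 0) :
    IsHausdorff (Ideal.span {(p : R)}) (Compl R) := by
  refine ⟨fun x hx => hS x fun s => ?_⟩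
  have h1 := hx s
  rw [SModEq.zero, mem_span_pow_smul_top_iff] at h1
  obtain ⟨y, hy⟩ := h1
  refine ⟨y, ?_⟩
  rw [hy, smul_compl, map_pow, map_natCast]

/-- A linear relation modulo `U_f(μ)` gives the corresponding relation between the periods. -/
theorem Dominant.periodHom_eq_sum (h : OddFrobenius p σ)
    (hS : ∀ x : Compl R, (∀ s : ℕ, (p : Compl R) ^ s ∣ x) → x = 0)
    (hσ : ∀ g : Laurent R n, Dominant v g → Dominant v (twist σ g)) (hf : Admissible μ f)
    (hd : Dominant v f) {ι : Type*} (S : Finset ι) (c : ι → R) (θ : ι → Omega f μ)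
    {x : OmegaHat p f μ} {s : Compl R} (hs : hd.periodHat p μ x = AdicCompletion.of _ _ s)
    (hx : x - ∑ i ∈ S, c i • toHat p f μ (θ i) ∈ U p σ f μ) :
    s = ∑ i ∈ S, toCompl R (c i) * hd.periodHom μ (θ i) := by
  -- Separatedness of `S` brings the relation back from the completion of `S` to `S`.
  have := isHausdorff_compl hS
  have h1 := hd.periodHat_eq_zero h hσ hf hx
  simp only [map_sub, hs, map_sum, map_smul, hd.periodHat_toHat] at h1
  rw [← sub_eq_zero]
  simp only [← smul_compl]
  refine eq_zero_of_forall_mem (a := (p : R)) fun s => of_mem_iff.1 ?_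
  rw [map_sub, map_sum]
  simp only [map_smul]
  rw [h1]
  exact Submodule.zero_mem _

end PeriodHom

/-! ### Frobenius lifts and derivations acting on periods -/

section Extensions

open UniformSpace

set_option linter.unusedSectionVars false

variable {R : Type*} [NormedCommRing R] [NormMulClass R] [IsUltrametricDist R] [IsDomain R] {n : ℕ}
  {v : Fin n → ℤ} {f : Laurent R n}

theorem continuous_of_norm_lt {σ : R →+* R} (hσ : ∀ a b : R, ‖a‖ < ‖b‖ → ‖σ a‖ < ‖σ b‖) :
    Continuous σ := by
  have := NormMulClass.toNormOneClass (α := R)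
  refine continuous_of_continuousAt_zero σ ?_
  rw [ContinuousAt, map_zero, Metric.tendsto_nhds_nhds]
  intro ε hε
  simp only [dist_zero_right]
  -- If such `π` exists, powers of `π` serve as radii, since `‖σ π‖ < 1`. Otherwise every nonzero
  -- element has norm at least `1` and the topology is discrete.
  by_cases h : ∃ π : R, π ≠ 0 ∧ ‖π‖ < 1
  · obtain ⟨π, hπ, hπ1⟩ := h
    have h1 : ‖σ π‖ < 1 := by
      have := hσ π 1 (by rwa [norm_one])
      rwa [map_one, norm_one] at this
    obtain ⟨m, hm⟩ := exists_pow_lt_of_lt_one hε h1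
    refine ⟨‖π ^ m‖, norm_pos_iff.2 (pow_ne_zero m hπ), fun a ha => (hσ _ _ ha).trans ?_⟩
    rwa [map_pow, norm_pow]
  · push Not at h
    refine ⟨1, one_pos, fun {a} ha => ?_⟩
    have ha0 : a = 0 := by
      by_contra h0
      exact absurd ha (not_lt.2 (h a h0))
    rwa [ha0, map_zero, norm_zero]

theorem injective_of_norm_lt {σ : R →+* R} (hσ : ∀ a b : R, ‖a‖ < ‖b‖ → ‖σ a‖ < ‖σ b‖) :
    Function.Injective σ := by
  refine (injective_iff_map_eq_zero σ).2 fun b hb => ?_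
  by_contra h0
  have := hσ 0 b (by rwa [norm_zero, norm_pos_iff])
  rw [hb, map_zero] at this
  exact lt_irrefl _ this

theorem extend_toCompl {φ : R →+ R} (hφ : Continuous φ) (r : R) :
    extend φ (toCompl R r) = toCompl R (φ r) :=
  Completion.map_coe (uniformContinuous_addMonoidHom_of_continuous hφ) r

/-! ### Compatibility of periods with the Frobenius lift -/

section Frobenius

variable {σ : R →+* R}

theorem Dominant.twisted (hσ : ∀ a b : R, ‖a‖ < ‖b‖ → ‖σ a‖ < ‖σ b‖) (hd : Dominant v f) :
    Dominant v (twist σ f) := by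
  refine ⟨fun w hw => ?_, ?_⟩
  · rw [coeff_twist, coeff_twist]
    exact hσ _ _ (hd.lt w hw)
  · have h1 := hd.isUnit.map (Completion.mapRingHom σ (continuous_of_norm_lt hσ))
    rwa [toCompl_apply, Completion.mapRingHom_coe, ← coeff_twist] at h1

/-- Applying a continuous ring endomorphism to the coefficients of a Laurent series. -/
def twistSeries (σ : R →+* R) (hσ : Continuous σ) (n : ℕ) : ConvSeries R n →+* ConvSeries R n :=
  Completion.mapRingHom (AddMonoidAlgebra.mapRingHom (Fin n → ℤ) σ)
    (continuous_laurent_map (φ := (σ : R →+ R)) hσ)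

theorem twistSeries_toSeries (hσ : Continuous σ) (P : Laurent R n) :
    twistSeries σ hσ n (toSeries R n P) = toSeries R n (twist σ P) :=
  Completion.mapRingHom_coe _ _

theorem extend_constCoeff (hσ : Continuous σ) (x : ConvSeries R n) :
    extend σ (constCoeff R n x) = constCoeff R n (twistSeries σ hσ n x) := by
  induction x using series_induction with
  | hC =>
    exact isClosed_eq (Completion.continuous_map.comp continuous_constCoeff)
      (continuous_constCoeff.comp Completion.continuous_map)
  | h P =>
    rw [constCoeff_toSeries, twistSeries_toSeries, constCoeff_toSeries, coeff_twist]
    exact extend_toCompl (φ := (σ : R →+ R)) hσ _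

theorem Dominant.extend_seriesPeriod (hσ : ∀ a b : R, ‖a‖ < ‖b‖ → ‖σ a‖ < ‖σ b‖)
    (hd : Dominant v f) (g : Laurent R n) (k : ℕ) :
    extend σ (seriesPeriod f g k) = seriesPeriod (twist σ f) (twist σ g) k := by
  have hc := continuous_of_norm_lt hσ
  have h1 : twistSeries σ hc n (invSeries f) = invSeries (twist σ f) := by
    have h2 := congrArg (twistSeries σ hc n) hd.mul_invSeries
    rw [map_mul, twistSeries_toSeries, map_one] at h2
    rw [← one_mul (invSeries (twist σ f)), ← h2, mul_right_comm, (hd.twisted hσ).mul_invSeries,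
      one_mul]
  rw [seriesPeriod, extend_constCoeff hc, map_mul, map_pow, h1, twistSeries_toSeries]; rfl

end Frobenius

/-! ### Compatibility of periods with derivations -/

section Derivations

variable {δ : Derivation ℤ R R}

theorem coeff_coeffDeriv (f : Laurent R n) (u : Fin n → ℤ) :
    (coeffDeriv δ f).coeff u = δ (f.coeff u) := rfl

theorem coeffDeriv_add (f g : Laurent R n) :
    coeffDeriv δ (f + g) = coeffDeriv δ f + coeffDeriv δ g :=
  AddMonoidAlgebra.ext (Finsupp.ext fun _ => map_add δ _ _)

theorem coeffDeriv_mono (u : Fin n → ℤ) (c : R) : coeffDeriv δ (mono u c) = mono u (δ c) := by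
  ext w
  rw [coeff_coeffDeriv, coeff_mono, coeff_mono]
  split_ifs
  · rfl
  · exact map_zero δ

/-- The action of a derivation on the coefficients, as an additive map. -/
def coeffDerivHom (δ : Derivation ℤ R R) (n : ℕ) : Laurent R n →+ Laurent R n :=
  AddMonoidHom.mk' (coeffDeriv δ) coeffDeriv_add

theorem coeffDerivHom_apply (P : Laurent R n) : coeffDerivHom δ n P = coeffDeriv δ P := rfl

theorem coeffDeriv_mul (f g : Laurent R n) :
    coeffDeriv δ (f * g) = f * coeffDeriv δ g + g * coeffDeriv δ f := by
  simp only [← coeffDerivHom_apply]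
  induction f using laurent_induction with
  | h0 => simp
  | hs u c =>
    induction g using laurent_induction with
    | h0 => simp
    | hs w d =>
      simp only [coeffDerivHom_apply, mono_mul_mono, coeffDeriv_mono, Derivation.leibniz,
        smul_eq_mul, add_comm w u]
      exact AddMonoidAlgebra.single_add _ _ _
    | ha x y hx hy => rw [mul_add, map_add, hx, hy, map_add]; ring
  | ha x y hx hy => rw [add_mul, map_add, hx, hy, map_add]; ring

theorem continuous_coeffDerivHom (hδ : Continuous δ) : Continuous (coeffDerivHom δ n) :=
  continuous_laurent_map (φ := δ.toLinearMap.toAddMonoidHom) hδ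

/-- Applying a continuous derivation to the coefficients of a Laurent series. -/
def derivSeries (δ : Derivation ℤ R R) (hδ : Continuous δ) (n : ℕ) :
    ConvSeries R n →+ ConvSeries R n :=
  (coeffDerivHom δ n).completion (continuous_coeffDerivHom hδ)

theorem derivSeries_toSeries (hδ : Continuous δ) (P : Laurent R n) :
    derivSeries δ hδ n (toSeries R n P) = toSeries R n (coeffDeriv δ P) :=
  AddMonoidHom.completion_coe _ _ _

theorem continuous_derivSeries (hδ : Continuous δ) : Continuous (derivSeries δ hδ n) :=
  AddMonoidHom.continuous_completion _ _

theorem derivSeries_mul (hδ : Continuous δ) (x y : ConvSeries R n) :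
    derivSeries δ hδ n (x * y) = x * derivSeries δ hδ n y + y * derivSeries δ hδ n x := by
  have hc := continuous_derivSeries (n := n) hδ
  induction x using series_induction with
  | hC =>
    exact isClosed_eq (hc.comp (continuous_id.mul continuous_const))
      ((continuous_id.mul continuous_const).add (continuous_const.mul hc))
  | h P =>
    induction y using series_induction with
    | hC =>
      exact isClosed_eq (hc.comp (continuous_const.mul continuous_id))
        ((continuous_const.mul hc).add (continuous_id.mul continuous_const))
    | h Q =>
      rw [← map_mul, derivSeries_toSeries, derivSeries_toSeries, derivSeries_toSeries,
        coeffDeriv_mul, map_add, map_mul, map_mul]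

theorem extend_derivation_constCoeff (hδ : Continuous δ) (x : ConvSeries R n) :
    extend δ (constCoeff R n x) = constCoeff R n (derivSeries δ hδ n x) := by
  induction x using series_induction with
  | hC =>
    exact isClosed_eq (Completion.continuous_map.comp continuous_constCoeff)
      (continuous_constCoeff.comp (continuous_derivSeries hδ))
  | h P =>
    rw [constCoeff_toSeries, derivSeries_toSeries, constCoeff_toSeries, coeff_coeffDeriv]
    exact extend_toCompl (φ := δ.toLinearMap.toAddMonoidHom) hδ _

/-- The quotient rule in the ring of series, obtained by differentiating `f · f⁻¹ = 1`; the monomial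
`x^u` has constant coefficients and is killed. -/
theorem Dominant.extend_derivation_seriesPeriod (hδ : Continuous δ) (hd : Dominant v f)
    (u : Fin n → ℤ) :
    extend δ (seriesPeriod f (mono u 1) 1) =
      seriesPeriod f (-(mono u 1 * coeffDeriv δ f)) 2 := by
  have h0 : derivSeries δ hδ n (toSeries R n (mono u 1)) = 0 := by
    rw [derivSeries_toSeries, coeffDeriv_mono, Derivation.map_one_eq_zero]
    exact (congrArg _ (AddMonoidAlgebra.single_zero _)).trans (map_zero _)
  have h1 : derivSeries δ hδ n 1 = 0 := by
    have := derivSeries_mul hδ (1 : ConvSeries R n) 1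
    rw [one_mul, one_mul] at this
    exact left_eq_add.1 this
  have h2 := congrArg (derivSeries δ hδ n) hd.mul_invSeries
  rw [h1, derivSeries_mul, derivSeries_toSeries] at h2
  rw [seriesPeriod, extend_derivation_constCoeff hδ, pow_one, derivSeries_mul, h0, mul_zero,
    add_zero, seriesPeriod, map_neg, (toSeries R n).map_mul]
  congr 1
  linear_combination (invSeries f * toSeries R n (mono u 1)) * h2 -
    (toSeries R n (mono u 1) * derivSeries δ hδ n (invSeries f)) * hd.mul_invSeries

end Derivations

end Extensions

/-! ### The main theorem -/

section Main

set_option linter.unusedSectionVars false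

variable {R : Type*} [CommRing R] [IsDomain R] [CharZero R] {p : ℕ}
  [IsAdicComplete (Ideal.span {(p : R)}) R] {n : ℕ} {σ : R →+* R} {f : Laurent R n}
  {μ : Set (Fin n → ℝ)}

theorem Ordinary.existsUnique_frobeniusMatrix (h : OddFrobenius p σ) (hf : Ordinary p μ f) :
    ∃! Λ, IsFrobeniusMatrix p σ f μ Λ := by
  have key := fun u : latticePts f μ =>
    (hf.twisted h.injective).existsUnique_coeffs h (mem_latticePts hf.isOpen)
      (cartier p σ f μ (toHat p f μ (omegaElt f (toReal_mem u))))
  choose c hc hu using key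
  exact ⟨c, hc, fun Λ hΛ => funext fun u => hu u (Λ u) (hΛ u)⟩

/-- The rational function `δ(x^u / f)` lies in `Ω_f(μ)`. -/
theorem Admissible.exists_derivation_omegaElt (hf : Admissible μ f) (δ : Derivation ℤ R R)
    {u : Fin n → ℤ} (hu : toReal u ∈ μ) :
    ∃ η : Omega f μ, (η : RatFun R n) = frac (-(mono u 1 * coeffDeriv δ f)) f 2 := by
  have hs : SuppIn (-(mono u 1 * coeffDeriv δ f)) 2 μ :=
    (hf.suppIn_mul le_rfl (suppIn_mono 1 (by simpa using hu)) (suppIn_coeffDeriv δ f) rfl).neg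
  have := factorial_smul_frac_mem (f := f) (Nat.le_succ 1) hs
  exact ⟨⟨_, this⟩, by simp⟩

theorem Ordinary.existsUnique_connectionMatrix (h : OddFrobenius p σ) (hf : Ordinary p μ f)
    (δ : Derivation ℤ R R) : ∃! N, IsConnectionMatrix p σ δ f μ N := by
  choose η hη using fun u : latticePts f μ =>
    hf.toAdmissible.exists_derivation_omegaElt δ (toReal_mem u)
  have key := fun u : latticePts f μ =>
    hf.existsUnique_coeffs h (mem_latticePts hf.isOpen) (toHat p f μ (η u))
  choose c hc hu using key
  refine ⟨c, fun u => ⟨η u, hη u, hc u⟩, fun N hN => funext fun u => hu u (N u) ?_⟩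
  obtain ⟨η', hη', hm⟩ := hN u
  rwa [Subtype.ext (hη'.trans (hη u).symm)] at hm

end Main

/-! ### The Frobenius and differential equations of the period vector -/

section MainPeriods

set_option linter.unusedSectionVars false

variable {R : Type*} [NormedCommRing R] [NormMulClass R] [IsUltrametricDist R] [IsDomain R]
  [CharZero R] {p : ℕ} [IsAdicComplete (Ideal.span {(p : R)}) R] {n : ℕ} {σ : R →+* R}
  {f : Laurent R n} {μ : Set (Fin n → ℝ)} {v : Fin n → ℤ}

theorem Dominant.periodHom_omegaElt (hd : Dominant v f) {u : Fin n → ℤ} (hu : toReal u ∈ μ) :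
    hd.periodHom μ (omegaElt f hu) = seriesPeriod f (mono u 1) 1 :=
  hd.periodHom_eq (isPeriod_frac _ _ _)

theorem Dominant.periodVec_eq (hd : Dominant v f) (u : latticePts f μ) :
    periodVec f v μ u = seriesPeriod f (mono u.1 1) 1 :=
  hd.periodMap_one _

theorem Dominant.periodVec_frobenius (h : OddFrobenius p σ)
    (hS : ∀ x : Compl R, (∀ s : ℕ, (p : Compl R) ^ s ∣ x) → x = 0)
    (hσ : ∀ a b : R, ‖a‖ < ‖b‖ → ‖σ a‖ < ‖σ b‖) (hf : Admissible μ f) (hd : Dominant v f)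
    {Λ : Matrix (latticePts f μ) (latticePts f μ) R} (hΛ : IsFrobeniusMatrix p σ f μ Λ) :
    periodVec f v μ =
      (Λ.map (toCompl R)).mulVec (fun w => extend σ (periodVec f v μ w)) := by
  funext u
  have hdσ := hd.twisted hσ
  have h1 := LinearMap.congr_fun (Dominant.periodHat_comp_cartier h hf hd hdσ)
    (toHat p f μ (omegaElt f (toReal_mem u)))
  rw [LinearMap.comp_apply, hd.periodHat_toHat] at h1
  -- The relation lives over `f^σ`; by invariance the period of `𝒞_p ω_u` there is the period of
  -- `ω_u` over `f`.
  have h2 := hdσ.periodHom_eq_sum h hS (fun g hg => hg.twisted hσ) (hf.twisted h.injective) _ _ _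
    h1 (hΛ u)
  rw [hd.periodHom_omegaElt, ← hd.periodVec_eq] at h2
  rw [h2, Matrix.mulVec, dotProduct]
  refine Finset.sum_congr rfl fun w _ => ?_
  rw [hdσ.periodHom_omegaElt, hd.periodVec_eq, hd.extend_seriesPeriod hσ, twist_mono, map_one]
  rfl

theorem Dominant.periodVec_derivation (h : OddFrobenius p σ)
    (hS : ∀ x : Compl R, (∀ s : ℕ, (p : Compl R) ^ s ∣ x) → x = 0)
    (hσ : ∀ a b : R, ‖a‖ < ‖b‖ → ‖σ a‖ < ‖σ b‖) (hf : Admissible μ f) (hd : Dominant v f)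
    {δ : Derivation ℤ R R} (hδ : Continuous δ)
    {N : Matrix (latticePts f μ) (latticePts f μ) R} (hN : IsConnectionMatrix p σ δ f μ N) :
    (fun u => extend δ (periodVec f v μ u)) = (N.map (toCompl R)).mulVec (periodVec f v μ) := by
  funext u
  obtain ⟨η, hη, hm⟩ := hN u
  have h1 := hd.periodHom_eq_sum h hS (fun g hg => hg.twisted hσ) hf _ _ _
    (hd.periodHat_toHat η) hm
  rw [hd.periodHom_eq (hη ▸ isPeriod_frac f _ 2), ← hd.extend_derivation_seriesPeriod hδ,
    ← hd.periodVec_eq] at h1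
  rw [h1, Matrix.mulVec, dotProduct]
  refine Finset.sum_congr rfl fun w _ => ?_
  rw [hd.periodHom_omegaElt, hd.periodVec_eq]
  rfl

end MainPeriods

end DworkCrystal

end

theorem mainTheorem4 {R : Type*} [NormedCommRing R] [NormMulClass R] [IsUltrametricDist R]
    [IsDomain R] [CharZero R] (p : ℕ) (hp : p.Prime) (hp2 : p ≠ 2)
    [IsAdicComplete (Ideal.span {(p : R)}) R]
    {n : ℕ} (f : DworkCrystal.Laurent R n) (μ : Set (Fin n → ℝ))
    (hμ : DworkCrystal.IsOpenIn (DworkCrystal.newton f) μ)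
    (hβ : IsUnit (DworkCrystal.hasseWitt p f μ))
    (v : Fin n → ℤ) (hv : ∀ w, w ≠ v → ‖f.coeff w‖ < ‖f.coeff v‖)
    (hvS : IsUnit (DworkCrystal.toCompl R (f.coeff v)))
    (hS : ∀ x : DworkCrystal.Compl R, (∀ s : ℕ, (p : DworkCrystal.Compl R) ^ s ∣ x) → x = 0)
    (σ : R →+* R) (hσ : DworkCrystal.IsFrobeniusLift p σ)
    (hσt : ∀ a b : R, ‖a‖ < ‖b‖ → ‖σ a‖ < ‖σ b‖)
    (δ : Derivation ℤ R R) (hδ : Continuous δ) :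
    (∀ s : ℕ, ∃! C, DworkCrystal.IsCartier p σ (DworkCrystal.twistIter σ s f) μ C) ∧
    (∃! Λ, DworkCrystal.IsFrobeniusMatrix p σ f μ Λ) ∧
    (∃! N, DworkCrystal.IsConnectionMatrix p σ δ f μ N) ∧
    (∀ Λ, DworkCrystal.IsFrobeniusMatrix p σ f μ Λ →
      DworkCrystal.periodVec f v μ =
        (Λ.map (DworkCrystal.toCompl R)).mulVec
          (fun w => DworkCrystal.extend σ (DworkCrystal.periodVec f v μ w))) ∧
    (∀ N, DworkCrystal.IsConnectionMatrix p σ δ f μ N →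
      (fun u => DworkCrystal.extend δ (DworkCrystal.periodVec f v μ u)) =
        (N.map (DworkCrystal.toCompl R)).mulVec (DworkCrystal.periodVec f v μ)) := by
  have hd : DworkCrystal.Dominant v f := ⟨hv, hvS⟩
  have h : DworkCrystal.OddFrobenius p σ :=
    -- Injectivity of `σ` comes from strict monotonicity for the absolute value, just as `f ≠ 0`
    -- below comes from the dominant coefficient.
    ⟨hp, hp2, hσ, DworkCrystal.injective_of_norm_lt hσt⟩
  have hf : DworkCrystal.Admissible μ f := ⟨hd.ne_zero, hμ⟩
  have ho : DworkCrystal.Ordinary p μ f := ⟨hf, hβ⟩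
  exact ⟨fun s => DworkCrystal.existsUnique_isCartier h
      (DworkCrystal.twistIter_admissible h.injective s hf),
    ho.existsUnique_frobeniusMatrix h, ho.existsUnique_connectionMatrix h δ,
    fun Λ hΛ => hd.periodVec_frobenius h hS hσt hf hΛ,
    fun N hN => hd.periodVec_derivation h hS hσt hf hδ hN⟩
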